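/- Let $\mathbb F$ be a finite field, $t=1/|\mathbb F|$, and let $m\ge 1$ and $n,p\ge 0$ be integers. A system $(A,B,C,D)\in\mathbb F^{n\times n}\times\mathbb F^{n\times m}\times\mathbb F^{p\times n}\times\mathbb F^{p\times m}$, i.e. $x(\tau+1)=Ax(\tau)+Bu(\tau)$, $y(\tau)=Cx(\tau)+Du(\tau)$, is called minimal if it is reachable (every state can be reached from the zero state in finitely many steps by a suitable input sequence) and observable (for each input sequence, the output sequence determines the initial state). A matrix $Q=(q_{ij})\in\mathbb F[z]^{m\times m}$ is in Kronecker-Hermite form if every $q_{ii}$ is monic, $\deg q_{ij}<\deg q_{ii}$ for $j\neq i$, $\deg q_{ji}<\deg q_{ii}$ for $j<i$, and $\deg q_{ji}\le\deg q_{ii}$ for $j>i$ (with $\deg 0=-\infty$). Let $M(p,n,m)$ be the set of all $G=\begin{pmatrix}Q\\P\end{pmatrix}\in\mathbb F[z]^{(m+p)\times m}$ with $Q\in\mathbb F[z]^{m\times m}$ in Kronecker-Hermite form, $\deg(\det Q)=n$, $P\in\mathbb F[z]^{p\times m}$, and $\deg_jP\le\deg_jQ$ for $j=1,\dots,m$,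 where $\deg_j$ denotes the maximal degree of the entries of the $j$-th column. Then $M(p,n,m)$ is finite and nonempty. Let $P^{rc}_{p,n,m}(t)$ be the probability that a uniformly distributed $G\in M(p,n,m)$ is right prime, i.e. that there is $Y\in\mathbb F[z]^{m\times(m+p)}$ with $YG=I_m$. Put $$P_{n,m}(t)=\prod_{j=m}^{n+m-1}(1-t^j).$$ Then $P_{n,m}(t)$ is the probability that a uniformly distributed pair $(A,B)\in\mathbb F^{n\times n}\times\mathbb F^{n\times m}$ is reachable, and the probability that a uniformly distributed system $(A,B,C,D)\in\mathbb F^{n\times n}\times\mathbb F^{n\times m}\times\mathbb F^{p\times n}\times\mathbb F^{p\times m}$ is minimal is exactly $$P^{rc}_{p,n,m}(t)\cdot P_{n,m}(t).$$ -/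

import Mathlib

open Polynomial

noncomputable section

namespace LinSys

/-- The state trajectory of `x(τ+1) = A x(τ) + B u(τ)`, started at `x(0) = x₀`, for the input
sequence `u`. -/
def state {F : Type*} [Field F] {n m : ℕ} (A : Matrix (Fin n) (Fin n) F)
    (B : Matrix (Fin n) (Fin m) F) (x₀ : Fin n → F) (u : ℕ → Fin m → F) : ℕ → Fin n → F
  | 0 => x₀
  | τ + 1 => A.mulVec (state A B x₀ u τ) + B.mulVec (u τ)

/-- The output sequence `y(τ) = C x(τ) + D u(τ)`. -/
def output {F : Type*} [Field F] {n m p : ℕ} (A : Matrix (Fin n) (Fin n) F)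
    (B : Matrix (Fin n) (Fin m) F) (C : Matrix (Fin p) (Fin n) F) (D : Matrix (Fin p) (Fin m) F)
    (x₀ : Fin n → F) (u : ℕ → Fin m → F) (τ : ℕ) : Fin p → F :=
  C.mulVec (state A B x₀ u τ) + D.mulVec (u τ)

/-- `(A, B)` is reachable: every state can be reached from the zero state in finitely many
steps. -/
def Reachable {F : Type*} [Field F] {n m : ℕ} (A : Matrix (Fin n) (Fin n) F)
    (B : Matrix (Fin n) (Fin m) F) : Prop :=
  ∀ x : Fin n → F, ∃ (u : ℕ → Fin m → F) (N : ℕ), state A B 0 u N = x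

/-- `(A, B, C, D)` is observable: for known input, the output sequence determines the initial
state. -/
def Observable {F : Type*} [Field F] {n m p : ℕ} (A : Matrix (Fin n) (Fin n) F)
    (B : Matrix (Fin n) (Fin m) F) (C : Matrix (Fin p) (Fin n) F)
    (D : Matrix (Fin p) (Fin m) F) : Prop :=
  ∀ (u : ℕ → Fin m → F) (x₀ x₁ : Fin n → F),
    (∀ τ, output A B C D x₀ u τ = output A B C D x₁ u τ) → x₀ = x₁

/-- A system is minimal if it is reachable and observable. -/
def IsMinimal {F : Type*} [Field F] {n m p : ℕ} (A : Matrix (Fin n) (Fin n) F)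
    (B : Matrix (Fin n) (Fin m) F) (C : Matrix (Fin p) (Fin n) F)
    (D : Matrix (Fin p) (Fin m) F) : Prop :=
  Reachable A B ∧ Observable A B C D

/-- The `j`-th column degree of a polynomial matrix (`⊥` for a zero column). -/
def colDegree {F : Type*} [Field F] {ι κ : Type*} [Fintype ι] (H : Matrix ι κ F[X]) (j : κ) :
    WithBot ℕ :=
  Finset.univ.sup fun i => (H i j).degree

/-- `Q` is in Kronecker-Hermite (canonical) form. -/
structure IsKroneckerHermite {F : Type*} [Field F] {m : ℕ}
    (Q : Matrix (Fin m) (Fin m) F[X]) : Prop where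
  monic_diag : ∀ i, (Q i i).Monic
  row_lt : ∀ i j, j ≠ i → (Q i j).degree < (Q i i).degree
  col_above_lt : ∀ i j, j < i → (Q j i).degree < (Q i i).degree
  col_below_le : ∀ i j, i < j → (Q j i).degree ≤ (Q i i).degree

/-- `G` is right prime: it has a polynomial left inverse. -/
def IsRightPrime {F : Type*} [Field F] {ι κ : Type*} [Fintype ι] [DecidableEq κ]
    (G : Matrix ι κ F[X]) : Prop :=
  ∃ Y : Matrix κ ι F[X], Y * G = 1

/-- The set `M(p,n,m)` of polynomial matrices `G` with upper block `Q` (of size `m × m`) and lower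
block `P` (of size `p × m`), where `Q` is in Kronecker-Hermite form with `deg (det Q) = n` and
`deg_j P ≤ deg_j Q` for every column `j`. -/
def matrixSet (F : Type*) [Field F] (p n m : ℕ) :
    Set (Matrix (Fin m ⊕ Fin p) (Fin m) F[X]) :=
  {G | IsKroneckerHermite G.toRows₁ ∧ G.toRows₁.det.degree = (n : WithBot ℕ) ∧
    ∀ j, colDegree G.toRows₂ j ≤ colDegree G.toRows₁ j}

/-- The probability that a uniformly distributed element of the finite nonempty set `Ω` lies in
`S`. -/
def uniformProb {α : Type*} (Ω S : Set α) : ℝ :=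
  ((Ω ∩ S).ncard : ℝ) / (Ω.ncard : ℝ)

/-- `P^{rc}_{p,n,m}(t)`, where `t = 1/|F|`. -/
def rightPrimeProb (F : Type*) [Field F] (p n m : ℕ) : ℝ :=
  uniformProb (matrixSet F p n m) {G | IsRightPrime G}

/-- The probability that a uniformly distributed pair `(A, B)` is reachable. -/
def reachableProb (F : Type*) [Field F] (n m : ℕ) : ℝ :=
  uniformProb (Set.univ : Set (Matrix (Fin n) (Fin n) F × Matrix (Fin n) (Fin m) F))
    {s | Reachable s.1 s.2}

/-- The probability that a uniformly distributed system `(A, B, C, D)` is minimal. -/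
def minimalProb (F : Type*) [Field F] (p n m : ℕ) : ℝ :=
  uniformProb
    (Set.univ : Set (Matrix (Fin n) (Fin n) F × Matrix (Fin n) (Fin m) F ×
      Matrix (Fin p) (Fin n) F × Matrix (Fin p) (Fin m) F))
    {s | IsMinimal s.1 s.2.1 s.2.2.1 s.2.2.2}

/-- `P_{n,m}(t) = ∏_{j=m}^{n+m-1} (1 - t^j)` (the empty product for `n = 0`). -/
def reachPoly (n m : ℕ) (t : ℝ) : ℝ :=
  ∏ j ∈ Finset.Ico m (n + m), (1 - t ^ j)

end LinSys

end

/-! Reachable systems are fibred over `matrixSet`, with all fibres of the same size. For a pair `(A,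
B)`, the map `reachMap` sends `∑ X^k u_k` to `∑ A^k B u_k`. Reachability is its surjectivity, and
its kernel is an `F[X]`-submodule of `F[X]^m`, of codimension `n` in the reachable case.
Kronecker-Hermite matrices are reduced Gröbner bases for a degree-first monomial order, so this
kernel is the column module of exactly one such `Q`. Then `N = (X - A)⁻¹ B Q` is polynomial, and `P
= C N + D Q` is the numerator of the transfer function `P Q⁻¹`. Hence a reachable system realizes
exactly one `G = (Q, P)` (`existsUnique_realizes`).

Conversely, fix `G`. The pairs with kernel `colSpan Q` correspond to identifications of `F[X]^m /
colSpan Q` with `F^n`, a torsor under `GL_n(F)`; a dimension count shows that `P` then determines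
`(C, D)`. So every fibre has `|GL_n(F)|` elements (`card_realizes`). Bezout identities show that
within a fibre observability means right primeness of `G` (`Realizes.observable_iff_isRightPrime`).
The proportion of observable systems among the reachable ones is therefore the proportion of right
prime matrices in `matrixSet`.

Reachable pairs are counted by induction on `n` (`card_generates`): for fixed `B` with range `W`,
only the blocks of `A` into a complement of `W` matter, and they form a smaller reachability
problem. The sum over `B` becomes a count of surjections. -/

namespace LinSys

/-! ### Reachability, observability and the kernel of the input-to-state map. -/

section ReachMap

variable {F : Type*} [Field F] {n m p : ℕ}

/-- The map `F[X]^m → F^n` sending `∑ X^k u_k` to `∑ A^k B u_k`. -/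
noncomputable def reachMap (A : Matrix (Fin n) (Fin n) F) (B : Matrix (Fin n) (Fin m) F) :
    (Fin m → F[X]) →ₗ[F] (Fin n → F) where
  toFun v := ∑ j, (aeval A (v j)).mulVec (B.col j)
  map_add' v w := by
    simp [Matrix.add_mulVec, Finset.sum_add_distrib]
  map_smul' c v := by
    simp [Matrix.smul_mulVec, Finset.smul_sum]

lemma reachMap_apply (A : Matrix (Fin n) (Fin n) F) (B : Matrix (Fin n) (Fin m) F)
    (v : Fin m → F[X]) : reachMap A B v = ∑ j, (aeval A (v j)).mulVec (B.col j) := rfl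

lemma reachMap_smul (A : Matrix (Fin n) (Fin n) F) (B : Matrix (Fin n) (Fin m) F) (f : F[X])
    (v : Fin m → F[X]) : reachMap A B (f • v) = (aeval A f).mulVec (reachMap A B v) := by
  simp [reachMap_apply, Matrix.mulVec_sum]

lemma reachMap_X_smul (A : Matrix (Fin n) (Fin n) F) (B : Matrix (Fin n) (Fin m) F)
    (v : Fin m → F[X]) : reachMap A B ((X : F[X]) • v) = A.mulVec (reachMap A B v) := by
  simp [reachMap_smul]

lemma reachMap_const (A : Matrix (Fin n) (Fin n) F) (B : Matrix (Fin n) (Fin m) F)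
    (u : Fin m → F) : reachMap A B (fun j => C (u j)) = B.mulVec u := by
  simp only [reachMap_apply, aeval_C]
  ext i
  simp [Matrix.mulVec, dotProduct, Matrix.algebraMap_eq_diagonal, Matrix.diagonal_apply,
    Finset.sum_apply, mul_comm]

/-- Polynomial vectors are built up by multiplication with `X` and addition of constants. -/
lemma polyVec_induction {P : (Fin m → F[X]) → Prop} (h0 : P 0)
    (step : ∀ v (u : Fin m → F), P v → P ((X : F[X]) • v + fun j => C (u j))) (v) : P v := by
  suffices h : ∀ (N : ℕ) (v : Fin m → F[X]), (∀ j, (v j).natDegree < N) → P v by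
    exact h ((Finset.univ.sup fun j => (v j).natDegree) + 1) v fun j =>
      Nat.lt_succ_of_le (Finset.le_sup (f := fun j => (v j).natDegree) (Finset.mem_univ j))
  intro N
  induction N with
  | zero =>
    intro v hv
    have : v = 0 := funext fun j => absurd (hv j) (Nat.not_lt_zero _)
    exact this ▸ h0
  | succ N ih =>
    intro v hv
    by_cases hz : ∀ j, (v j).natDegree = 0
    · have : v = (X : F[X]) • (0 : Fin m → F[X]) + fun j => C ((v j).coeff 0) := by
        ext1 j
        simpa using eq_C_of_natDegree_eq_zero (hz j)
      rw [this]
      exact step _ _ h0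
    · have : v = (X : F[X]) • (fun j => divX (v j)) + fun j => C ((v j).coeff 0) := by
        ext1 j
        simp [X_mul_divX_add]
      push Not at hz
      obtain ⟨j0, hj0⟩ := hz
      have hN := hv j0
      rw [this]
      refine step _ _ (ih _ fun j => ?_)
      have := hv j
      rw [natDegree_divX_eq_natDegree_tsub_one]
      omega

lemma state_congr (A : Matrix (Fin n) (Fin n) F) (B : Matrix (Fin n) (Fin m) F) (x : Fin n → F)
    {u u' : ℕ → Fin m → F} {N : ℕ} (h : ∀ τ < N, u τ = u' τ) :
    state A B x u N = state A B x u' N := by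
  induction N with
  | zero => rfl
  | succ N ih =>
    simp only [state]
    rw [ih fun τ hτ => h τ (hτ.trans N.lt_succ_self), h N N.lt_succ_self]

lemma exists_state_eq_reachMap (A : Matrix (Fin n) (Fin n) F) (B : Matrix (Fin n) (Fin m) F)
    (v : Fin m → F[X]) : ∃ (u : ℕ → Fin m → F) (N : ℕ), state A B 0 u N = reachMap A B v := by
  induction v using polyVec_induction with
  | h0 => exact ⟨0, 0, by simp [state]⟩
  | step v w ih =>
    obtain ⟨u, N, h⟩ := ih
    refine ⟨Function.update u N w, N + 1, ?_⟩
    have : state A B 0 (Function.update u N w) N = state A B 0 u N :=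
      state_congr A B 0 fun τ hτ => Function.update_of_ne hτ.ne _ _
    rw [state, this, h, map_add, reachMap_X_smul, reachMap_const]
    simp

lemma state_mem_range_reachMap (A : Matrix (Fin n) (Fin n) F) (B : Matrix (Fin n) (Fin m) F)
    (u : ℕ → Fin m → F) (N : ℕ) : ∃ v, reachMap A B v = state A B 0 u N := by
  induction N with
  | zero => exact ⟨0, by simp [state]⟩
  | succ N ih =>
    obtain ⟨v, hv⟩ := ih
    exact ⟨(X : F[X]) • v + fun j => C (u N j),
      by rw [map_add, reachMap_X_smul, reachMap_const, hv]; rfl⟩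

theorem reachable_iff_surjective (A : Matrix (Fin n) (Fin n) F) (B : Matrix (Fin n) (Fin m) F) :
    Reachable A B ↔ Function.Surjective (reachMap A B) := by
  constructor
  · intro h x
    obtain ⟨u, N, rfl⟩ := h x
    exact state_mem_range_reachMap A B u N
  · intro h x
    obtain ⟨v, rfl⟩ := h x
    exact exists_state_eq_reachMap A B v

/-- The range of `reachMap` is the smallest `A`-invariant subspace containing the range of `B`. This
form serves both the duality with observability and the counting. -/
theorem reachable_iff_forall_submodule (A : Matrix (Fin n) (Fin n) F)
    (B : Matrix (Fin n) (Fin m) F) :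
    Reachable A B ↔ ∀ W : Submodule F (Fin n → F), (∀ u, B.mulVec u ∈ W) →
      (∀ x ∈ W, A.mulVec x ∈ W) → W = ⊤ := by
  rw [reachable_iff_surjective]
  constructor
  · intro h W hB hA
    rw [eq_top_iff]
    rintro x -
    obtain ⟨v, rfl⟩ := h x
    induction v using polyVec_induction with
    | h0 => simp
    | step v u ih =>
      rw [map_add, reachMap_X_smul, reachMap_const]
      exact W.add_mem (hA _ ih) (hB _)
  · intro h
    rw [← LinearMap.range_eq_top]
    refine h _ (fun u => ⟨_, reachMap_const A B u⟩) ?_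
    rintro _ ⟨v, rfl⟩
    exact ⟨_, reachMap_X_smul A B v⟩

lemma state_sub_state (A : Matrix (Fin n) (Fin n) F) (B : Matrix (Fin n) (Fin m) F)
    (x₀ x₁ : Fin n → F) (u : ℕ → Fin m → F) (τ : ℕ) :
    state A B x₀ u τ - state A B x₁ u τ = (A ^ τ).mulVec (x₀ - x₁) := by
  induction τ with
  | zero => simp [state]
  | succ τ ih =>
    rw [state, state, add_sub_add_right_eq_sub, ← Matrix.mulVec_sub, ih, Matrix.mulVec_mulVec,
      pow_succ']

/-- The input cancels from the difference of two trajectories, so only `x₀ - x₁` matters. -/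
theorem observable_iff (A : Matrix (Fin n) (Fin n) F) (B : Matrix (Fin n) (Fin m) F)
    (C : Matrix (Fin p) (Fin n) F) (D : Matrix (Fin p) (Fin m) F) :
    Observable A B C D ↔ ∀ x : Fin n → F, (∀ k, C.mulVec ((A ^ k).mulVec x) = 0) → x = 0 := by
  have key : ∀ u x₀ x₁ τ, output A B C D x₀ u τ = output A B C D x₁ u τ ↔
      C.mulVec ((A ^ τ).mulVec (x₀ - x₁)) = 0 := by
    intro u x₀ x₁ τ
    rw [output, output, add_left_inj, ← sub_eq_zero, ← Matrix.mulVec_sub, state_sub_state]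
  constructor
  · intro h x hx
    exact h 0 x 0 fun τ => (key _ _ _ _).2 (by rw [sub_zero]; exact hx τ)
  · intro h u x₀ x₁ hx
    exact sub_eq_zero.1 (h _ fun k => (key _ _ _ _).1 (hx k))

/-- Constant polynomial vectors. -/
noncomputable def constVec (x : Fin n → F) : Fin n → F[X] := fun i => C (x i)

@[simp] lemma constVec_apply (x : Fin n → F) (i : Fin n) : constVec x i = C (x i) := rfl

@[simp] lemma constVec_zero : constVec (0 : Fin n → F) = 0 := by ext1; simp

lemma constVec_add (x y : Fin n → F) : constVec (x + y) = constVec x + constVec y := by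
  ext1; simp

lemma map_C_mulVec_constVec (B : Matrix (Fin n) (Fin m) F) (u : Fin m → F) :
    (B.map C).mulVec (constVec u) = constVec (B.mulVec u) := by
  ext1 i
  simp [Matrix.mulVec, dotProduct]

lemma charmatrix_mulVec (A : Matrix (Fin n) (Fin n) F) (s : Fin n → F[X]) :
    A.charmatrix.mulVec s = (X : F[X]) • s - (A.map C).mulVec s := by
  rw [Matrix.charmatrix, Matrix.sub_mulVec]
  congr 1
  simp [Matrix.scalar_apply, ← Matrix.smul_one_eq_diagonal, Matrix.smul_mulVec]

lemma charmatrix_mulVec_injective (A : Matrix (Fin n) (Fin n) F) :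
    Function.Injective A.charmatrix.mulVec := by
  intro s s' h
  rw [← sub_eq_zero]
  refine Matrix.eq_zero_of_mulVec_eq_zero (M := A.charmatrix) A.charpoly_monic.ne_zero ?_
  rw [Matrix.mulVec_sub, h, sub_self]

/-- Division of `B v` by `X - A`: modulo the image of `X - A`, multiplication by `X` on constants is
`A`, so the constant remainder is the reached state. -/
lemma exists_charmatrix_mulVec_add (A : Matrix (Fin n) (Fin n) F) (B : Matrix (Fin n) (Fin m) F)
    (v : Fin m → F[X]) :
    ∃ s, (B.map C).mulVec v = A.charmatrix.mulVec s + constVec (reachMap A B v) := by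
  induction v using polyVec_induction with
  | h0 => exact ⟨0, by simp⟩
  | step v u ih =>
    obtain ⟨s, hs⟩ := ih
    refine ⟨(X : F[X]) • s + constVec (reachMap A B v), ?_⟩
    rw [map_add, reachMap_X_smul, reachMap_const, Matrix.mulVec_add, Matrix.mulVec_smul, hs,
      Matrix.mulVec_add, Matrix.mulVec_smul, charmatrix_mulVec A (constVec _), constVec_add,
      map_C_mulVec_constVec]
    change _ + (B.map C).mulVec (constVec u) = _
    rw [map_C_mulVec_constVec, smul_add]
    abel

lemma reachMap_map_C_mulVec (A : Matrix (Fin n) (Fin n) F) (B : Matrix (Fin n) (Fin m) F)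
    (v : Fin m → F[X]) : reachMap A 1 ((B.map C).mulVec v) = reachMap A B v := by
  induction v using polyVec_induction with
  | h0 => simp
  | step v u ih =>
    have : (fun j => C (u j)) = constVec u := rfl
    rw [map_add, reachMap_X_smul, reachMap_const, Matrix.mulVec_add, Matrix.mulVec_smul, this,
      map_C_mulVec_constVec, map_add, reachMap_X_smul, ih]
    congr 1
    exact (reachMap_const A 1 _).trans (by simp)

lemma reachMap_one_charmatrix_mulVec (A : Matrix (Fin n) (Fin n) F) (s : Fin n → F[X]) :
    reachMap A 1 (A.charmatrix.mulVec s) = 0 := by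
  rw [charmatrix_mulVec, map_sub, reachMap_X_smul, reachMap_map_C_mulVec, sub_eq_zero]
  induction s using polyVec_induction with
  | h0 => simp
  | step v u ih =>
    simp only [map_add, reachMap_X_smul, reachMap_const, Matrix.mulVec_add, ih,
      Matrix.one_mulVec]

/-- The kernel consists of the `v` for which `(X - A)⁻¹ B v` is polynomial; this links the kernel to
the denominators of the transfer function. -/
lemma reachMap_eq_zero_iff (A : Matrix (Fin n) (Fin n) F) (B : Matrix (Fin n) (Fin m) F)
    (v : Fin m → F[X]) :
    reachMap A B v = 0 ↔ ∃ s, (B.map C).mulVec v = A.charmatrix.mulVec s := by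
  constructor
  · intro h
    obtain ⟨s, hs⟩ := exists_charmatrix_mulVec_add A B v
    exact ⟨s, by simpa [h] using hs⟩
  · rintro ⟨s, hs⟩
    rw [← reachMap_map_C_mulVec, hs, reachMap_one_charmatrix_mulVec]

/-- The kernel of `reachMap`, as an `F[X]`-submodule. -/
noncomputable def reachKer (A : Matrix (Fin n) (Fin n) F) (B : Matrix (Fin n) (Fin m) F) :
    Submodule F[X] (Fin m → F[X]) where
  carrier := {v | reachMap A B v = 0}
  add_mem' {v w} (hv : reachMap A B v = 0) (hw : reachMap A B w = 0) :=
    show reachMap A B (v + w) = 0 by rw [map_add, hv, hw, add_zero]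
  zero_mem' := map_zero _
  smul_mem' f v (hv : reachMap A B v = 0) :=
    show reachMap A B (f • v) = 0 by rw [reachMap_smul, hv, Matrix.mulVec_zero]

lemma mem_reachKer {A : Matrix (Fin n) (Fin n) F} {B : Matrix (Fin n) (Fin m) F}
    {v : Fin m → F[X]} : v ∈ reachKer A B ↔ reachMap A B v = 0 := Iff.rfl

/-- By Cayley-Hamilton the quotient by the kernel is torsion, as needed for a square basis. -/
lemma charpoly_smul_mem_reachKer (A : Matrix (Fin n) (Fin n) F) (B : Matrix (Fin n) (Fin m) F)
    (v : Fin m → F[X]) : A.charpoly • v ∈ reachKer A B := by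
  rw [mem_reachKer, reachMap_smul, Matrix.aeval_self_charpoly, Matrix.zero_mulVec]

end ReachMap

/-! ### A monomial order on `F[X]^m` and division with remainder. -/

section Interleave

variable {F : Type*} [Field F] {m : ℕ}

/-- The polynomial whose coefficients are those of the entries of `v`, listed by degree and, within
a degree, from the last entry to the first. -/
noncomputable def interleave (v : Fin m → F[X]) : F[X] :=
  ∑ i, X ^ (i.rev : ℕ) * expand F m (v i)

lemma interleave_add (v w : Fin m → F[X]) :
    interleave (v + w) = interleave v + interleave w := by
  simp [interleave, mul_add, Finset.sum_add_distrib]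

lemma interleave_smul (f : F[X]) (v : Fin m → F[X]) :
    interleave (f • v) = expand F m f * interleave v := by
  simp only [interleave, Finset.mul_sum, Pi.smul_apply, smul_eq_mul, map_mul]
  exact Finset.sum_congr rfl fun i _ => by ring

@[simp] lemma interleave_zero : interleave (0 : Fin m → F[X]) = 0 := by simp [interleave]

lemma interleave_sub (v w : Fin m → F[X]) :
    interleave (v - w) = interleave v - interleave w := by
  rw [eq_sub_iff_add_eq, ← interleave_add, sub_add_cancel]

lemma interleave_sum {ι : Type*} (s : Finset ι) (v : ι → Fin m → F[X]) :
    interleave (∑ i ∈ s, v i) = ∑ i ∈ s, interleave (v i) := by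
  induction s using Finset.cons_induction with
  | empty => simp
  | cons a s ha ih => rw [Finset.sum_cons, Finset.sum_cons, interleave_add, ih]

/-- The exponents of the interleaved polynomial enumerate the monomials `X^k e_i` in increasing
order, so the order on monomials is the order on `ℕ`. -/
lemma exists_eq_mul_add_rev (hm : 0 < m) (N : ℕ) : ∃ (i : Fin m) (k : ℕ), N = m * k + i.rev :=
  ⟨Fin.rev ⟨N % m, Nat.mod_lt _ hm⟩, N / m, by simp [Fin.rev_rev, Nat.div_add_mod]⟩

lemma mul_add_rev_inj {i j : Fin m} {k l : ℕ} (h : m * k + i.rev = m * l + j.rev) :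
    i = j ∧ k = l := by
  have hi := i.rev.isLt
  have hj := j.rev.isLt
  have h1 : (m * k + i.rev) % m = i.rev := by rw [Nat.mul_add_mod, Nat.mod_eq_of_lt hi]
  have h2 : (m * l + j.rev) % m = j.rev := by rw [Nat.mul_add_mod, Nat.mod_eq_of_lt hj]
  have h3 : (i.rev : ℕ) = j.rev := by rw [← h1, ← h2, h]
  have h4 : m * k = m * l := by omega
  exact ⟨Fin.rev_injective (Fin.ext h3), Nat.eq_of_mul_eq_mul_left (by omega) h4⟩

lemma le_of_mul_add_rev_le {i j : Fin m} {k l : ℕ} (h : m * k + i.rev ≤ m * l + j.rev) :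
    k ≤ l := by
  by_contra! hlt
  have : m * (l + 1) ≤ m * k := Nat.mul_le_mul_left m hlt
  have hj := j.rev.isLt
  rw [Nat.mul_succ] at this
  omega

lemma coeff_interleave (v : Fin m → F[X]) (i : Fin m) (k : ℕ) :
    (interleave v).coeff (m * k + i.rev) = (v i).coeff k := by
  have hm : 0 < m := i.pos
  rw [interleave, finsetSum_coeff, Finset.sum_eq_single i]
  · rw [add_comm (m * k), add_comm, coeff_X_pow_mul, mul_comm, coeff_expand_mul hm]
  · intro j _ hj
    rw [coeff_X_pow_mul']
    split_ifs with h
    · rw [coeff_expand hm, if_neg]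
      rintro ⟨l, hl⟩
      exact hj (mul_add_rev_inj (show m * l + j.rev = m * k + i.rev by omega)).1
    · rfl
  · simp

lemma interleave_injective : Function.Injective (interleave : (Fin m → F[X]) → F[X]) := by
  intro v w h
  ext i k
  rw [← coeff_interleave, h, coeff_interleave]

lemma interleave_eq_zero {v : Fin m → F[X]} : interleave v = 0 ↔ v = 0 :=
  ⟨fun h => interleave_injective (h.trans interleave_zero.symm), fun h => h ▸ interleave_zero⟩

lemma natDegree_interleave_le (hm : 0 < m) {v : Fin m → F[X]} {N : ℕ}
    (h : ∀ (i : Fin m) (k : ℕ), N < m * k + i.rev → (v i).coeff k = 0) :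
    (interleave v).natDegree ≤ N := by
  rw [natDegree_le_iff_coeff_eq_zero]
  intro N' hN'
  obtain ⟨i, k, rfl⟩ := exists_eq_mul_add_rev hm N'
  rw [coeff_interleave]
  exact h i k hN'

/-- The leading monomial of `v` is `X^k e_i`, with coefficient one, for the order which compares
degrees first and prefers the smaller index within a degree. -/
def HasLead (v : Fin m → F[X]) (i : Fin m) (k : ℕ) : Prop :=
  (interleave v).Monic ∧ (interleave v).natDegree = m * k + i.rev

lemma hasLead_iff {v : Fin m → F[X]} {i : Fin m} {k : ℕ} :
    HasLead v i k ↔ (v i).coeff k = 1 ∧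
      ∀ (j : Fin m) (l : ℕ), m * k + i.rev < m * l + j.rev → (v j).coeff l = 0 := by
  constructor
  · rintro ⟨h1, h2⟩
    refine ⟨?_, fun j l h => ?_⟩
    · rw [← coeff_interleave, ← h2]
      exact h1
    · rw [← coeff_interleave]
      exact coeff_eq_zero_of_natDegree_lt (h2 ▸ h)
  · rintro ⟨h1, h2⟩
    have h3 := natDegree_interleave_le i.pos h2
    rw [← coeff_interleave] at h1
    exact ⟨monic_of_natDegree_le_of_coeff_eq_one _ h3 h1,
      natDegree_eq_of_le_of_coeff_ne_zero h3 (h1 ▸ one_ne_zero)⟩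

lemma exists_hasLead_C_smul {v : Fin m → F[X]} (hv : v ≠ 0) :
    ∃ (c : F) (i : Fin m) (k : ℕ), HasLead ((C c : F[X]) • v) i k ∧
      (interleave v).natDegree = m * k + i.rev := by
  have hm : 0 < m := by
    rcases Nat.eq_zero_or_pos m with rfl | h
    · exact absurd (Subsingleton.elim v 0) hv
    · exact h
  have h0 : interleave v ≠ 0 := fun h => hv (interleave_eq_zero.1 h)
  obtain ⟨i, k, h⟩ := exists_eq_mul_add_rev hm (interleave v).natDegree
  have hc : (interleave v).leadingCoeff ≠ 0 := leadingCoeff_ne_zero.2 h0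
  refine ⟨(interleave v).leadingCoeff⁻¹, i, k, ⟨?_, ?_⟩, h⟩
  · rw [interleave_smul, expand_C, mul_comm]
    exact monic_mul_leadingCoeff_inv h0
  · rw [interleave_smul, expand_C, natDegree_C_mul (inv_ne_zero hc), h]

variable {g : Fin m → Fin m → F[X]} {κ : Fin m → ℕ}

/-- Division with remainder by a family of vectors with prescribed leading monomials. -/
lemma exists_sub_mem_span (hg : ∀ i, HasLead (g i) i (κ i)) (v : Fin m → F[X]) :
    ∃ r : Fin m → F[X], v - r ∈ Submodule.span F[X] (Set.range g) ∧
      ∀ i, (r i).degree < κ i := by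
  rcases Nat.eq_zero_or_pos m with rfl | hm
  · exact ⟨0, by simp [Subsingleton.elim v 0], fun i => i.elim0⟩
  suffices h : ∀ (N : ℕ) (v : Fin m → F[X]), (interleave v).degree < N →
      ∃ r : Fin m → F[X], v - r ∈ Submodule.span F[X] (Set.range g) ∧
        ∀ i, (r i).degree < κ i by
    exact h ((interleave v).natDegree + 1) v
      (lt_of_le_of_lt degree_le_natDegree (by exact_mod_cast Nat.lt_succ_self _))
  intro N
  induction N with
  | zero =>
    intro v hv
    have : v = 0 := by
      rw [← interleave_eq_zero, ← degree_eq_bot]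
      exact Nat.WithBot.lt_zero_iff.1 (by simpa using hv)
    exact ⟨0, by simp [this], fun i => by simp⟩
  | succ N ih =>
    intro v hv
    obtain ⟨i, k, rfl⟩ := exists_eq_mul_add_rev hm N
    -- The top monomial `X^k e_i` is cancelled by a multiple of `g i` if `κ i ≤ k`, and is otherwise
    -- moved into the remainder.
    set c := (v i).coeff k with hc
    have hlead : ∀ w : Fin m → F[X], HasLead w i k →
        (interleave (v - (C c : F[X]) • w)).degree < ((m * k + i.rev : ℕ) : WithBot ℕ) := by
      intro w hw
      rw [degree_lt_iff_coeff_zero]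
      intro l hl
      rw [interleave_sub, interleave_smul, expand_C, coeff_sub, coeff_C_mul]
      rcases hl.eq_or_lt with rfl | hl
      · rw [coeff_interleave, coeff_interleave, (hasLead_iff.1 hw).1, ← hc, mul_one, sub_self]
      · rw [coeff_eq_zero_of_degree_lt (lt_of_lt_of_le hv (by exact_mod_cast hl)),
          coeff_eq_zero_of_natDegree_lt (hw.2 ▸ hl), mul_zero, sub_self]
    by_cases hk : κ i ≤ k
    · have hw : HasLead ((X : F[X]) ^ (k - κ i) • g i) i k := by
        obtain ⟨h1, h2⟩ := hg i
        have h3 : ((X : F[X]) ^ (m * (k - κ i))).Monic := monic_X_pow _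
        constructor
        · rw [interleave_smul, map_pow, expand_X, ← pow_mul]
          exact h3.mul h1
        · rw [interleave_smul, map_pow, expand_X, ← pow_mul, h3.natDegree_mul h1, h2,
            natDegree_X_pow, ← add_assoc, ← mul_add, Nat.sub_add_cancel hk]
      obtain ⟨r, hr, hr'⟩ := ih _ (hlead _ hw)
      refine ⟨r, ?_, hr'⟩
      have hmem : (C c : F[X]) • (X : F[X]) ^ (k - κ i) • g i ∈
          Submodule.span F[X] (Set.range g) :=
        Submodule.smul_mem _ _ (Submodule.smul_mem _ _ (Submodule.subset_span ⟨i, rfl⟩))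
      have := Submodule.add_mem _ hr hmem
      rwa [sub_right_comm, sub_add_cancel] at this
    · have hw : HasLead (Pi.single i ((X : F[X]) ^ k)) i k := by
        rw [hasLead_iff]
        refine ⟨by simp, fun j l h => ?_⟩
        by_cases hji : j = i
        · subst hji
          have : l ≠ k := by rintro rfl; exact lt_irrefl _ h
          simp [coeff_X_pow, this]
        · simp [hji]
      obtain ⟨r, hr, hr'⟩ := ih _ (hlead _ hw)
      refine ⟨r + (C c : F[X]) • Pi.single i ((X : F[X]) ^ k), ?_, fun j => ?_⟩
      · rwa [← sub_sub, sub_right_comm]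
      · refine lt_of_le_of_lt (degree_add_le _ _) (max_lt (hr' j) ?_)
        change (C c * (Pi.single i ((X : F[X]) ^ k) : Fin m → F[X]) j).degree < _
        by_cases hji : j = i
        · rw [hji, Pi.single_eq_same]
          refine lt_of_le_of_lt (degree_C_mul_X_pow_le _ _) ?_
          exact_mod_cast not_le.1 hk
        · rw [Pi.single_eq_of_ne hji, mul_zero, degree_zero]
          exact WithBot.bot_lt_coe _

/-- A polynomial multiple of `g j` keeps its leading index `j`, which is read off from the
interleaved degree modulo `m`. The nonzero summands thus have distinct degrees and their leading
terms cannot cancel. -/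
lemma exists_natDegree_interleave_sum (hg : ∀ i, HasLead (g i) i (κ i)) {w : Fin m → F[X]}
    (hw : w ≠ 0) : ∃ (i : Fin m) (k : ℕ), κ i ≤ k ∧ ∑ j, w j • g j ≠ 0 ∧
      (interleave (∑ j, w j • g j)).natDegree = m * k + i.rev := by
  have hne : ∃ j, w j ≠ 0 := by
    by_contra! h
    exact hw (funext h)
  obtain ⟨j0, hj0⟩ := hne
  have hm : 0 < m := j0.pos
  set f : Fin m → F[X] := fun j => expand F m (w j) * interleave (g j) with hf
  have hf0 : ∀ j, w j ≠ 0 → f j ≠ 0 := fun j hj =>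
    mul_ne_zero ((expand_ne_zero hm).2 hj) (hg j).1.ne_zero
  have hdeg : ∀ j, f j ≠ 0 → (f j).natDegree = m * ((w j).natDegree + κ j) + j.rev := by
    intro j hj
    have : expand F m (w j) ≠ 0 := left_ne_zero_of_mul hj
    rw [hf]
    simp only
    rw [natDegree_mul this (hg j).1.ne_zero, natDegree_expand, (hg j).2]
    ring
  have hsum : interleave (∑ j, w j • g j) = ∑ j, f j := by
    rw [interleave_sum]
    exact Finset.sum_congr rfl fun j _ => interleave_smul _ _
  have hd : degree (∑ j, f j) = Finset.univ.sup fun j => degree (f j) := by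
    refine degree_sum_eq_of_disjoint _ _ ?_
    rintro i ⟨-, hi⟩ j ⟨-, hj⟩ hij h
    have h' := natDegree_eq_of_degree_eq h
    rw [hdeg i hi, hdeg j hj] at h'
    exact hij (mul_add_rev_inj h').1
  have : (Finset.univ : Finset (Fin m)).Nonempty := ⟨j0, Finset.mem_univ _⟩
  obtain ⟨i, -, hi⟩ := Finset.exists_mem_eq_sup _ this fun j => degree (f j)
  rw [hi] at hd
  have hi0 : f i ≠ 0 := by
    intro h0
    have h1 : degree (f j0) ≤ degree (f i) := by
      rw [← hi]
      exact Finset.le_sup (f := fun j => degree (f j)) (Finset.mem_univ j0)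
    rw [h0, degree_zero, le_bot_iff, degree_eq_bot] at h1
    exact hf0 j0 hj0 h1
  refine ⟨i, (w i).natDegree + κ i, Nat.le_add_left _ _, ?_, ?_⟩
  · intro h0
    rw [← interleave_eq_zero, hsum] at h0
    rw [h0, degree_zero, eq_comm, degree_eq_bot] at hd
    exact hi0 hd
  · rw [hsum, natDegree_eq_of_degree_eq hd, hdeg i hi0]

lemma exists_natDegree_interleave_of_mem_span (hg : ∀ i, HasLead (g i) i (κ i))
    {v : Fin m → F[X]} (hv : v ∈ Submodule.span F[X] (Set.range g)) (hv0 : v ≠ 0) :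
    ∃ (i : Fin m) (k : ℕ), κ i ≤ k ∧ (interleave v).natDegree = m * k + i.rev := by
  obtain ⟨w, rfl⟩ := (Submodule.mem_span_range_iff_exists_fun _).1 hv
  have hw : w ≠ 0 := by
    rintro rfl
    simp at hv0
  obtain ⟨i, k, h1, -, h2⟩ := exists_natDegree_interleave_sum hg hw
  exact ⟨i, k, h1, h2⟩

lemma exists_coeff_ne_zero_of_natDegree {v : Fin m → F[X]} (hv0 : v ≠ 0) {i : Fin m} {k : ℕ}
    (h : (interleave v).natDegree = m * k + i.rev) : (v i).coeff k ≠ 0 := by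
  rw [← coeff_interleave, ← h]
  exact leadingCoeff_ne_zero.2 fun h => hv0 (interleave_eq_zero.1 h)

lemma eq_zero_of_mem_span_of_degree_lt (hg : ∀ i, HasLead (g i) i (κ i))
    {v : Fin m → F[X]} (hv : v ∈ Submodule.span F[X] (Set.range g))
    (h : ∀ i, (v i).degree < κ i) : v = 0 := by
  by_contra hv0
  obtain ⟨i, k, h1, h2⟩ := exists_natDegree_interleave_of_mem_span hg hv hv0
  refine exists_coeff_ne_zero_of_natDegree hv0 h2 (coeff_eq_zero_of_degree_lt ?_)
  exact lt_of_lt_of_le (h i) (by exact_mod_cast h1)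

end Interleave

/-! ### Kronecker-Hermite matrices as reduced Gröbner bases. -/

section KroneckerHermite

variable {F : Type*} [Field F] {m : ℕ}

/-- The `F[X]`-module generated by the columns of `Q`. -/
noncomputable def colSpan (Q : Matrix (Fin m) (Fin m) F[X]) : Submodule F[X] (Fin m → F[X]) :=
  Submodule.span F[X] (Set.range Q.col)

lemma sum_smul_col (Q : Matrix (Fin m) (Fin m) F[X]) (w : Fin m → F[X]) :
    ∑ j, w j • Q.col j = Q.mulVec w := by
  ext1 i
  simp [Matrix.mulVec, dotProduct, mul_comm]

lemma mem_colSpan {Q : Matrix (Fin m) (Fin m) F[X]} {v : Fin m → F[X]} :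
    v ∈ colSpan Q ↔ ∃ w, Q.mulVec w = v := by
  rw [colSpan, Submodule.mem_span_range_iff_exists_fun]
  simp only [sum_smul_col]

lemma IsKroneckerHermite.natDegree_le {Q : Matrix (Fin m) (Fin m) F[X]}
    (hQ : IsKroneckerHermite Q) (i j : Fin m) : (Q j i).degree ≤ (Q i i).natDegree := by
  rw [← degree_eq_natDegree (hQ.monic_diag i).ne_zero]
  rcases lt_trichotomy j i with h | rfl | h
  · exact (hQ.col_above_lt i j h).le
  · exact le_rfl
  · exact hQ.col_below_le i j h

/-- The strict bound above the diagonal and the weak one below it say that the diagonal entry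
carries the leading monomial when ties favour the smaller index. -/
lemma IsKroneckerHermite.hasLead {Q : Matrix (Fin m) (Fin m) F[X]}
    (hQ : IsKroneckerHermite Q) (i : Fin m) : HasLead (Q.col i) i (Q i i).natDegree := by
  rw [hasLead_iff]
  refine ⟨hQ.monic_diag i, fun j l h => ?_⟩
  have hle := le_of_mul_add_rev_le h.le
  rcases hle.eq_or_lt with h' | h'
  · subst h'
    have hji : j < i := Fin.rev_lt_rev.1 (Fin.lt_def.2 (by omega))
    refine coeff_eq_zero_of_degree_lt ?_
    rw [← degree_eq_natDegree (hQ.monic_diag i).ne_zero]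
    exact hQ.col_above_lt i j hji
  · exact coeff_eq_zero_of_degree_lt
      (lt_of_le_of_lt (hQ.natDegree_le i j) (by exact_mod_cast h'))

lemma isKroneckerHermite_of_hasLead {Q : Matrix (Fin m) (Fin m) F[X]} {κ : Fin m → ℕ}
    (h : ∀ i, HasLead (Q.col i) i (κ i)) (hrow : ∀ i j, j ≠ i → (Q i j).degree < κ i) :
    IsKroneckerHermite Q ∧ ∀ i, (Q i i).natDegree = κ i := by
  have hco := fun i => hasLead_iff.1 (h i)
  have hle : ∀ i j (l : ℕ), κ i < l → (Q j i).coeff l = 0 := by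
    intro i j l hl
    refine (hco i).2 j l ?_
    by_contra! hcon
    exact absurd (le_of_mul_add_rev_le hcon) (not_le.2 hl)
  have hmon : ∀ i, (Q i i).Monic ∧ (Q i i).natDegree = κ i := by
    intro i
    have h1 : (Q i i).coeff (κ i) = 1 := (hco i).1
    have h2 : (Q i i).natDegree ≤ κ i := natDegree_le_iff_coeff_eq_zero.2 (hle i i)
    exact ⟨monic_of_natDegree_le_of_coeff_eq_one _ h2 h1,
      natDegree_eq_of_le_of_coeff_ne_zero h2 (h1 ▸ one_ne_zero)⟩
  have hdeg : ∀ i, (Q i i).degree = κ i := fun i => by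
    rw [degree_eq_natDegree (hmon i).1.ne_zero, (hmon i).2]
  refine ⟨⟨fun i => (hmon i).1, fun i j hji => ?_, fun i j hji => ?_, fun i j _ => ?_⟩,
    fun i => (hmon i).2⟩
  · rw [hdeg]
    exact hrow i j hji
  · rw [hdeg, degree_lt_iff_coeff_zero]
    intro l hl
    rcases hl.eq_or_lt with rfl | hl
    · refine (hco i).2 j _ ?_
      have : (i.rev : ℕ) < j.rev := Fin.lt_def.1 (Fin.rev_lt_rev.2 hji)
      omega
    · exact hle i j l hl
  · rw [hdeg, degree_le_iff_coeff_zero]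
    intro l hl
    exact hle i j l (by exact_mod_cast hl)

lemma hasLead_smul_single {f : F[X]} (hf : f.Monic) (i : Fin m) :
    HasLead (f • Pi.single i (1 : F[X]) : Fin m → F[X]) i f.natDegree := by
  rw [hasLead_iff]
  have hval : ∀ j, (f • Pi.single i (1 : F[X]) : Fin m → F[X]) j = if j = i then f else 0 := by
    intro j
    rw [Pi.smul_apply, Pi.single_apply]
    split_ifs <;> simp
  refine ⟨by rw [hval, if_pos rfl]; exact hf, fun j l h => ?_⟩
  rw [hval]
  split_ifs with hji
  · subst hji
    refine coeff_eq_zero_of_natDegree_lt ?_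
    exact lt_of_le_of_ne (le_of_mul_add_rev_le h.le) (by rintro rfl; exact lt_irrefl _ h)
  · rfl

/-- Every submodule of `F[X]^m` with torsion quotient has a basis in Kronecker-Hermite form. -/
theorem exists_isKroneckerHermite (V : Submodule F[X] (Fin m → F[X])) {f : F[X]} (hf : f.Monic)
    (hV : ∀ v : Fin m → F[X], f • v ∈ V) :
    ∃ Q : Matrix (Fin m) (Fin m) F[X], IsKroneckerHermite Q ∧ colSpan Q = V := by
  classical
  have hex : ∀ i : Fin m, ∃ k, ∃ v ∈ V, HasLead v i k := fun i =>
    ⟨_, _, hV _, hasLead_smul_single hf i⟩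
  -- `κ i` is the least degree of a leading monomial with index `i` in `V`. By minimality any `g`
  -- attaining these degrees is a Gröbner basis; it still has to be reduced.
  set κ : Fin m → ℕ := fun i => Nat.find (hex i) with hκ
  choose g hgV hg using fun i => Nat.find_spec (hex i)
  have hmin : ∀ v ∈ V, v ≠ 0 → ∃ (i : Fin m) (k : ℕ), κ i ≤ k ∧ (v i).coeff k ≠ 0 ∧
      (interleave v).natDegree = m * k + i.rev := by
    intro v hv hv0
    obtain ⟨c, i, k, h1, h2⟩ := exists_hasLead_C_smul hv0
    exact ⟨i, k, Nat.find_min' (hex i) ⟨_, V.smul_mem _ hv, h1⟩,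
      exists_coeff_ne_zero_of_natDegree hv0 h2, h2⟩
  have hspan : Submodule.span F[X] (Set.range g) ≤ V := by
    rw [Submodule.span_le]
    rintro _ ⟨i, rfl⟩
    exact hgV i
  -- The reduced generator is `X^(κ i) e_i` minus its normal form.
  choose r hr hrdeg using fun i => exists_sub_mem_span hg
    ((X ^ κ i : F[X]) • Pi.single i (1 : F[X]))
  set q : Fin m → Fin m → F[X] := fun i => (X ^ κ i : F[X]) • Pi.single i (1 : F[X]) - r i with hq
  have hqV : ∀ i, q i ∈ V := fun i => hspan (hr i)
  have hX : ∀ i, HasLead ((X ^ κ i : F[X]) • Pi.single i (1 : F[X]) : Fin m → F[X]) i (κ i) := by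
    intro i
    simpa using hasLead_smul_single (monic_X_pow (R := F) (κ i)) i
  have hrc : ∀ i j l, κ j ≤ l → (r i j).coeff l = 0 := fun i j l hl =>
    coeff_eq_zero_of_degree_lt (lt_of_lt_of_le (hrdeg i j) (by exact_mod_cast hl))
  have hqi : ∀ i, (q i i).coeff (κ i) = 1 := by
    intro i
    have := (hasLead_iff.1 (hX i)).1
    rw [hq]
    simp only [Pi.sub_apply, coeff_sub]
    rw [this, hrc i i _ le_rfl, sub_zero]
  have hqj : ∀ i j, j ≠ i → q i j = - r i j := by
    intro i j hji
    rw [hq]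
    simp [hji]
  have hqc : ∀ i j l, κ j ≤ l → (q i j).coeff l ≠ 0 → j = i ∧ l = κ i := by
    intro i j l hl h
    by_cases hji : j = i
    · subst hji
      refine ⟨rfl, ?_⟩
      by_contra hne
      refine h ?_
      rw [hq]
      simp only [Pi.sub_apply, coeff_sub]
      rw [hrc j j l hl, sub_zero]
      simp [coeff_X_pow, hne]
    · rw [hqj i j hji, coeff_neg, hrc i j l hl, neg_zero] at h
      exact absurd rfl h
  -- The leading monomial of an element of `V` has degree at least `κ` at its index, and `X^(κ i)
  -- e_i` is the only such monomial occurring in `q i`.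
  have hlead : ∀ i, HasLead (q i) i (κ i) := by
    intro i
    have h0 : q i ≠ 0 := by
      intro h
      have := hqi i
      rw [h] at this
      simp at this
    obtain ⟨j, l, h1, h2, h3⟩ := hmin _ (hqV i) h0
    obtain ⟨rfl, rfl⟩ := hqc i j l h1 h2
    refine ⟨?_, h3⟩
    rw [Monic, leadingCoeff, h3, coeff_interleave, hqi]
  let Q : Matrix (Fin m) (Fin m) F[X] := Matrix.of fun i j => q j i
  obtain ⟨hKH, -⟩ := isKroneckerHermite_of_hasLead (Q := Q) (κ := κ) hlead (fun i j hji => by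
    change (q j i).degree < _
    rw [hqj j i hji.symm, degree_neg]
    exact hrdeg j i)
  refine ⟨Q, hKH, le_antisymm ?_ ?_⟩
  · rw [colSpan, Submodule.span_le]
    rintro _ ⟨i, rfl⟩
    exact hqV i
  · intro v hv
    obtain ⟨s, hs, hsdeg⟩ := exists_sub_mem_span hlead v
    have hle : Submodule.span F[X] (Set.range q) ≤ V := by
      rw [Submodule.span_le]
      rintro _ ⟨i, rfl⟩
      exact hqV i
    have hsV : s ∈ V := by
      have := V.sub_mem hv (hle hs)
      rwa [sub_sub_cancel] at this
    have hs0 : s = 0 := by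
      by_contra hs0
      obtain ⟨j, l, h1, h2, -⟩ := hmin _ hsV hs0
      exact h2 (coeff_eq_zero_of_degree_lt (lt_of_lt_of_le (hsdeg j) (by exact_mod_cast h1)))
    rw [hs0, sub_zero] at hs
    exact hs

lemma IsKroneckerHermite.natDegree_le_of_colSpan_le {Q Q' : Matrix (Fin m) (Fin m) F[X]}
    (hQ : IsKroneckerHermite Q) (hQ' : IsKroneckerHermite Q') (h : colSpan Q' ≤ colSpan Q)
    (i : Fin m) : (Q i i).natDegree ≤ (Q' i i).natDegree := by
  have hmem : Q'.col i ∈ colSpan Q := h (Submodule.subset_span ⟨i, rfl⟩)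
  have hlead := hQ'.hasLead i
  have h0 : Q'.col i ≠ 0 := fun h0 => hlead.1.ne_zero (interleave_eq_zero.2 h0)
  obtain ⟨j, k, h1, h2⟩ := exists_natDegree_interleave_of_mem_span hQ.hasLead hmem h0
  obtain ⟨rfl, rfl⟩ := mul_add_rev_inj (hlead.2.symm.trans h2)
  exact h1

/-- A matrix in Kronecker-Hermite form is determined by the module generated by its columns. -/
theorem IsKroneckerHermite.eq_of_colSpan_eq {Q Q' : Matrix (Fin m) (Fin m) F[X]}
    (hQ : IsKroneckerHermite Q) (hQ' : IsKroneckerHermite Q') (h : colSpan Q = colSpan Q') :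
    Q = Q' := by
  have hκ : ∀ i, (Q i i).natDegree = (Q' i i).natDegree := fun i =>
    le_antisymm (hQ.natDegree_le_of_colSpan_le hQ' h.ge i)
      (hQ'.natDegree_le_of_colSpan_le hQ h.le i)
  have hd : ∀ i, (Q i i).degree = (Q i i).natDegree := fun i =>
    degree_eq_natDegree (hQ.monic_diag i).ne_zero
  have hd' : ∀ i, (Q' i i).degree = (Q i i).natDegree := fun i => by
    rw [hκ i]
    exact degree_eq_natDegree (hQ'.monic_diag i).ne_zero
  ext1 i j
  suffices Q.col j - Q'.col j = 0 from sub_eq_zero.1 (congrFun this i)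
  -- Columns with the same index differ by a module element that is already reduced: on the diagonal
  -- the two monic leading terms cancel, elsewhere the row bounds apply.
  refine eq_zero_of_mem_span_of_degree_lt hQ.hasLead (Submodule.sub_mem _
    (Submodule.subset_span ⟨j, rfl⟩) (h.ge (Submodule.subset_span ⟨j, rfl⟩))) fun k => ?_
  change (Q k j - Q' k j).degree < _
  by_cases hkj : j = k
  · subst hkj
    rw [← hd]
    refine degree_sub_lt_left ((hd j).trans (hd' j).symm) (hQ.monic_diag j).ne_zero ?_
    rw [(hQ.monic_diag j).leadingCoeff, (hQ'.monic_diag j).leadingCoeff]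
  · refine lt_of_le_of_lt (degree_sub_le _ _) (max_lt ?_ ?_)
    · rw [← hd]
      exact hQ.row_lt k j hkj
    · rw [← hd' k]
      exact hQ'.row_lt k j hkj

lemma IsKroneckerHermite.mulVec_injective {Q : Matrix (Fin m) (Fin m) F[X]}
    (hQ : IsKroneckerHermite Q) : Function.Injective Q.mulVec := by
  intro w w' h
  by_contra hne
  obtain ⟨_, _, -, h0, -⟩ := exists_natDegree_interleave_sum hQ.hasLead (sub_ne_zero.2 hne)
  rw [sum_smul_col, Matrix.mulVec_sub, sub_ne_zero] at h0
  exact h0 h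

/-- The row bounds make the diagonal product dominate: any other permutation takes in some row an
entry of degree below the diagonal one. -/
lemma IsKroneckerHermite.degree_det {Q : Matrix (Fin m) (Fin m) F[X]}
    (hQ : IsKroneckerHermite Q) : Q.det.degree = ((∑ i, (Q i i).natDegree : ℕ) : WithBot ℕ) := by
  have hdiag : (∏ i, Q i i).degree = ((∑ i, (Q i i).natDegree : ℕ) : WithBot ℕ) := by
    rw [degree_eq_natDegree (Finset.prod_ne_zero_iff.2 fun i _ => (hQ.monic_diag i).ne_zero),
      natDegree_prod _ _ fun i _ => (hQ.monic_diag i).ne_zero]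
  have hlt : ∀ σ : Equiv.Perm (Fin m), σ ≠ 1 →
      (∏ i, Q (σ i) i).degree < ((∑ i, (Q i i).natDegree : ℕ) : WithBot ℕ) := by
    intro σ hσ
    by_cases h0 : ∏ i, Q (σ i) i = 0
    · rw [h0, degree_zero]
      exact WithBot.bot_lt_coe _
    have hne : ∀ i, Q (σ i) i ≠ 0 := fun i => Finset.prod_ne_zero_iff.1 h0 i (Finset.mem_univ i)
    rw [degree_eq_natDegree h0, natDegree_prod _ _ fun i _ => hne i,
      ← Equiv.sum_comp σ fun i => (Q i i).natDegree]
    have hi : ∃ i, σ i ≠ i := by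
      by_contra! h
      exact hσ (Equiv.ext h)
    obtain ⟨i, hi⟩ := hi
    have hstrict : ∀ j, σ j ≠ j → (Q (σ j) j).natDegree < (Q (σ j) (σ j)).natDegree := fun j hj =>
      natDegree_lt_natDegree (hne j) (hQ.row_lt (σ j) j hj.symm)
    have : ∑ j, (Q (σ j) j).natDegree < ∑ j, (Q (σ j) (σ j)).natDegree := by
      refine Finset.sum_lt_sum (fun j _ => ?_) ⟨i, Finset.mem_univ i, hstrict i hi⟩
      by_cases hj : σ j = j
      · rw [hj]
      · exact (hstrict j hj).le
    exact_mod_cast this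
  rw [Matrix.det_apply, ← Finset.add_sum_erase _ _ (Finset.mem_univ (1 : Equiv.Perm (Fin m)))]
  simp only [Equiv.Perm.sign_one, one_smul, Equiv.Perm.one_apply]
  rw [degree_add_eq_left_of_degree_lt, hdiag]
  rw [hdiag]
  refine lt_of_le_of_lt (degree_sum_le _ _) ?_
  rw [Finset.sup_lt_iff (WithBot.bot_lt_coe _)]
  intro σ hσ
  refine lt_of_le_of_lt ?_ (hlt σ (Finset.ne_of_mem_erase hσ))
  rcases Int.units_eq_one_or (Equiv.Perm.sign σ) with h | h <;> simp [h]

lemma IsKroneckerHermite.colDegree_eq {Q : Matrix (Fin m) (Fin m) F[X]}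
    (hQ : IsKroneckerHermite Q) (j : Fin m) : colDegree Q j = (Q j j).natDegree := by
  refine le_antisymm (Finset.sup_le fun i _ => hQ.natDegree_le j i) ?_
  rw [← degree_eq_natDegree (hQ.monic_diag j).ne_zero]
  exact Finset.le_sup (f := fun i => (Q i j).degree) (Finset.mem_univ j)

/-- The remainders modulo the columns of `Q`. -/
noncomputable def remainderEquiv {Q : Matrix (Fin m) (Fin m) F[X]} (hQ : IsKroneckerHermite Q) :
    (Π i, degreeLT F (Q i i).natDegree) ≃ₗ[F]
      (Fin m → F[X]) ⧸ (colSpan Q).restrictScalars F :=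
  LinearEquiv.ofBijective
    (((colSpan Q).restrictScalars F).mkQ ∘ₗ
      LinearMap.piMap fun i => (degreeLT F (Q i i).natDegree).subtype) <| by
    constructor
    · rw [← LinearMap.ker_eq_bot, LinearMap.ker_eq_bot']
      intro r hr
      have hr' : (fun i => (r i : F[X])) ∈ colSpan Q :=
        (Submodule.Quotient.mk_eq_zero _).1 hr
      have := eq_zero_of_mem_span_of_degree_lt hQ.hasLead hr' fun i => mem_degreeLT.1 (r i).2
      ext1 i
      exact Subtype.ext (congrFun this i)
    · intro x
      obtain ⟨v, rfl⟩ := Submodule.mkQ_surjective _ x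
      obtain ⟨r, hr, hrdeg⟩ := exists_sub_mem_span hQ.hasLead v
      refine ⟨fun i => ⟨r i, mem_degreeLT.2 (hrdeg i)⟩, ?_⟩
      exact ((Submodule.Quotient.eq _).2 hr).symm

instance (k : ℕ) : Module.Finite F (degreeLT F k) :=
  Module.Finite.equiv (degreeLTEquiv F k).symm

lemma finrank_degreeLT (k : ℕ) : Module.finrank F (degreeLT F k) = k := by
  rw [(degreeLTEquiv F k).finrank_eq, Module.finrank_fin_fun]

lemma IsKroneckerHermite.finite_quotient {Q : Matrix (Fin m) (Fin m) F[X]}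
    (hQ : IsKroneckerHermite Q) :
    Module.Finite F ((Fin m → F[X]) ⧸ (colSpan Q).restrictScalars F) :=
  Module.Finite.equiv (remainderEquiv hQ)

lemma IsKroneckerHermite.finrank_quotient {Q : Matrix (Fin m) (Fin m) F[X]}
    (hQ : IsKroneckerHermite Q) :
    Module.finrank F ((Fin m → F[X]) ⧸ (colSpan Q).restrictScalars F) =
      ∑ i, (Q i i).natDegree := by
  rw [← (remainderEquiv hQ).finrank_eq, Module.finrank_pi_fintype]
  simp only [finrank_degreeLT]

end KroneckerHermite

/-! ### Right fractions of the transfer function; observability and right primeness. -/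

section Realization

variable {F : Type*} [Field F] {n m p : ℕ}

lemma mem_reachKer_iff_exists {A : Matrix (Fin n) (Fin n) F} {B : Matrix (Fin n) (Fin m) F}
    {v : Fin m → F[X]} :
    v ∈ reachKer A B ↔ ∃ s, (B.map C).mulVec v = A.charmatrix.mulVec s :=
  reachMap_eq_zero_iff A B v

/-- If `(X - A) a = b`, then the coefficients of `a` lie in every `A`-invariant subspace which
contains the coefficients of `b`. -/
lemma coeff_mem_of_charmatrix_mulVec_eq {A : Matrix (Fin n) (Fin n) F} {a b : Fin n → F[X]}
    (h : A.charmatrix.mulVec a = b) (W : Submodule F (Fin n → F))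
    (hA : ∀ x ∈ W, A.mulVec x ∈ W) {k₀ : ℕ}
    (hb : ∀ k, k₀ < k → (fun i => (b i).coeff k) ∈ W) :
    ∀ k, k₀ ≤ k → (fun i => (a i).coeff k) ∈ W := by
  -- Comparing coefficients of `X^(k+1)` gives `a_k = A a_(k+1) + b_(k+1)`, a recursion running down
  -- from the vanishing high coefficients.
  have hrec : ∀ k, (fun i => (a i).coeff k) =
      A.mulVec (fun i => (a i).coeff (k + 1)) + fun i => (b i).coeff (k + 1) := by
    intro k
    ext1 i
    rw [← h, charmatrix_mulVec]
    simp [Matrix.mulVec, dotProduct, finsetSum_coeff, coeff_X_mul]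
  suffices hs : ∀ d k, k₀ ≤ k →
      (Finset.univ.sup fun i => (a i).natDegree) < k + d → (fun i => (a i).coeff k) ∈ W by
    intro k hk
    exact hs ((Finset.univ.sup fun i => (a i).natDegree) + 1) k hk (by omega)
  intro d
  induction d with
  | zero =>
    intro k _ hk
    have : (fun i => (a i).coeff k) = 0 := by
      ext1 i
      exact coeff_eq_zero_of_natDegree_lt (lt_of_le_of_lt
        (Finset.le_sup (f := fun i => (a i).natDegree) (Finset.mem_univ i)) hk)
    rw [this]
    exact W.zero_mem
  | succ d ih =>
    intro k hk hlt
    rw [hrec k]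
    exact W.add_mem (hA _ (ih (k + 1) (by omega) (by omega))) (hb _ (by omega))

lemma exists_eq_mul_of_reachKer_eq {A : Matrix (Fin n) (Fin n) F} {B : Matrix (Fin n) (Fin m) F}
    {Q : Matrix (Fin m) (Fin m) F[X]} (hker : reachKer A B = colSpan Q) {κ : Type*}
    {M : Matrix (Fin m) κ F[X]} {S : Matrix (Fin n) κ F[X]}
    (h : B.map C * M = A.charmatrix * S) : ∃ W : Matrix (Fin m) κ F[X], M = Q * W := by
  have hcol : ∀ k, ∃ w, Q.mulVec w = M.col k := by
    intro k
    rw [← mem_colSpan, ← hker, mem_reachKer_iff_exists]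
    refine ⟨S.col k, ?_⟩
    ext1 i
    exact congrFun (congrFun h i) k
  choose w hw using hcol
  refine ⟨Matrix.of fun i k => w k i, ?_⟩
  ext1 i k
  exact (congrFun (hw k) i).symm

lemma exists_numerator {A : Matrix (Fin n) (Fin n) F} {B : Matrix (Fin n) (Fin m) F}
    {Q : Matrix (Fin m) (Fin m) F[X]} (hker : reachKer A B = colSpan Q) :
    ∃ N : Matrix (Fin n) (Fin m) F[X], A.charmatrix * N = B.map C * Q := by
  have hcol : ∀ k, ∃ s, (B.map C).mulVec (Q.col k) = A.charmatrix.mulVec s := by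
    intro k
    rw [← mem_reachKer_iff_exists, hker]
    exact Submodule.subset_span ⟨k, rfl⟩
  choose s hs using hcol
  refine ⟨Matrix.of fun i k => s k i, ?_⟩
  ext1 i k
  exact (congrFun (hs k) i).symm

lemma charmatrix_mul_left_cancel {A : Matrix (Fin n) (Fin n) F}
    {N N' : Matrix (Fin n) (Fin m) F[X]} (h : A.charmatrix * N = A.charmatrix * N') : N = N' := by
  ext1 i j
  have : N.col j = N'.col j := by
    apply charmatrix_mulVec_injective A
    ext1 k
    exact congrFun (congrFun h k) j
  exact congrFun this i

lemma IsKroneckerHermite.mul_left_cancel {Q : Matrix (Fin m) (Fin m) F[X]}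
    (hQ : IsKroneckerHermite Q) {κ : Type*} {N N' : Matrix (Fin m) κ F[X]}
    (h : Q * N = Q * N') : N = N' := by
  ext1 i j
  have : N.col j = N'.col j := by
    apply hQ.mulVec_injective
    ext1 k
    exact congrFun (congrFun h k) j
  exact congrFun this i

/-- `N = (X - A)⁻¹ B Q`, and multiplication by `(X - A)⁻¹` lowers degrees; formally, the coefficient
recursion is run in the zero subspace. -/
lemma degree_numerator_lt {A : Matrix (Fin n) (Fin n) F} {B : Matrix (Fin n) (Fin m) F}
    {Q : Matrix (Fin m) (Fin m) F[X]} (hQ : IsKroneckerHermite Q)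
    {N : Matrix (Fin n) (Fin m) F[X]} (hN : A.charmatrix * N = B.map C * Q)
    (i : Fin n) (j : Fin m) : (N i j).degree < (Q j j).natDegree := by
  have hcol : A.charmatrix.mulVec (N.col j) = (B.map C).mulVec (Q.col j) := by
    ext1 k
    exact congrFun (congrFun hN k) j
  have hb : ∀ k, (Q j j).natDegree < k →
      (fun i => ((B.map C).mulVec (Q.col j) i).coeff k) ∈ (⊥ : Submodule F (Fin n → F)) := by
    intro k hk
    rw [Submodule.mem_bot]
    ext1 i
    simp only [Matrix.mulVec, dotProduct, finsetSum_coeff, Matrix.map_apply, coeff_C_mul,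
      Pi.zero_apply]
    refine Finset.sum_eq_zero fun l _ => ?_
    rw [Matrix.col_apply, coeff_eq_zero_of_degree_lt
      (lt_of_le_of_lt (hQ.natDegree_le j l) (by exact_mod_cast hk)), mul_zero]
  rw [degree_lt_iff_coeff_zero]
  intro k hk
  have := coeff_mem_of_charmatrix_mulVec_eq hcol ⊥
    (fun x hx => by rw [Submodule.mem_bot] at hx ⊢; rw [hx, Matrix.mulVec_zero]) hb k hk
  exact congrFun ((Submodule.mem_bot F).1 this) i

/-- Bezout identity for left coprimeness of `X - A` and `B`, from inputs reaching the unit vectors.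
-/
lemma Reachable.exists_mul_eq {A : Matrix (Fin n) (Fin n) F} {B : Matrix (Fin n) (Fin m) F}
    (h : Reachable A B) : ∃ (Y : Matrix (Fin m) (Fin n) F[X]) (S : Matrix (Fin n) (Fin n) F[X]),
      B.map C * Y = A.charmatrix * S + 1 := by
  rw [reachable_iff_surjective] at h
  choose v hv using fun i : Fin n => h (Pi.single i 1)
  choose s hs using fun i : Fin n => exists_charmatrix_mulVec_add A B (v i)
  refine ⟨Matrix.of fun i k => v k i, Matrix.of fun i k => s k i, ?_⟩
  ext1 i k
  refine (congrFun (hs k) i).trans ?_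
  rw [hv, Matrix.add_apply, Pi.add_apply]
  congr 1
  simp only [constVec_apply, Pi.single_apply, Matrix.one_apply]
  split_ifs <;> simp

/-- Duality: a vector annihilating a proper `Aᵀ`-invariant subspace that contains the range of `Cᵀ`
is an unobservable state. -/
lemma Observable.reachable_transpose {A : Matrix (Fin n) (Fin n) F}
    {B : Matrix (Fin n) (Fin m) F} {C : Matrix (Fin p) (Fin n) F} {D : Matrix (Fin p) (Fin m) F}
    (h : Observable A B C D) : Reachable A.transpose C.transpose := by
  rw [observable_iff] at h
  rw [reachable_iff_forall_submodule]
  intro W hC hA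
  by_contra hW
  obtain ⟨f, hf0, hf⟩ := Submodule.exists_le_ker_of_lt_top W (lt_top_iff_ne_top.2 hW)
  obtain ⟨x, rfl⟩ := (dotProductEquiv F (Fin n)).surjective f
  have hx : ∀ w ∈ W, w ⬝ᵥ x = 0 := by
    intro w hw
    rw [dotProduct_comm]
    exact LinearMap.mem_ker.1 (hf hw)
  have hxk : ∀ k, ∀ w ∈ W, w ⬝ᵥ (A ^ k).mulVec x = 0 := by
    intro k
    induction k with
    | zero => simpa using hx
    | succ k ih =>
      intro w hw
      rw [pow_succ', ← Matrix.mulVec_mulVec, Matrix.dotProduct_mulVec, ← Matrix.mulVec_transpose]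
      exact ih _ (hA w hw)
  refine hf0 ?_
  rw [h x fun k => ?_, map_zero]
  ext1 i
  have := hxk k _ (hC (Pi.single i 1))
  rwa [Matrix.mulVec_transpose, Matrix.single_one_vecMul] at this

/-- `(A, B)` is reachable, and the blocks `Q`, `P` of `G` are the denominator and the numerator of
a right fraction `P Q⁻¹` for the transfer function of `(A, B, C, D)`, where the columns of `Q`
generate the kernel of `reachMap A B`. -/
structure Realizes (A : Matrix (Fin n) (Fin n) F) (B : Matrix (Fin n) (Fin m) F)
    (C : Matrix (Fin p) (Fin n) F) (D : Matrix (Fin p) (Fin m) F)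
    (G : Matrix (Fin m ⊕ Fin p) (Fin m) F[X]) : Prop where
  reachable : Reachable A B
  ker_eq : reachKer A B = colSpan G.toRows₁
  transfer : ∃ N : Matrix (Fin n) (Fin m) F[X],
    A.charmatrix * N = B.map Polynomial.C * G.toRows₁ ∧
      G.toRows₂ = C.map Polynomial.C * N + D.map Polynomial.C * G.toRows₁

variable {A : Matrix (Fin n) (Fin n) F} {B : Matrix (Fin n) (Fin m) F}
    {C : Matrix (Fin p) (Fin n) F} {D : Matrix (Fin p) (Fin m) F}
    {G : Matrix (Fin m ⊕ Fin p) (Fin m) F[X]}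

lemma Realizes.isRightPrime (h : Realizes A B C D G) (hQ : IsKroneckerHermite G.toRows₁)
    (hobs : Observable A B C D) : IsRightPrime G := by
  obtain ⟨N, hN, hP⟩ := h.transfer
  obtain ⟨Y₁, S₁, h₁⟩ := h.reachable.exists_mul_eq
  obtain ⟨Y₂, S₂, h₂⟩ := hobs.reachable_transpose.exists_mul_eq
  have h₂' : Y₂.transpose * C.map Polynomial.C = S₂.transpose * A.charmatrix + 1 := by
    have := congrArg Matrix.transpose h₂
    rw [Matrix.transpose_mul, Matrix.transpose_add, Matrix.transpose_mul, Matrix.transpose_one,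
      Matrix.charmatrix_transpose, Matrix.transpose_transpose, Matrix.transpose_map,
      Matrix.transpose_transpose] at this
    exact this
  set Q := G.toRows₁
  set P := G.toRows₂
  set Bp := B.map Polynomial.C
  set Cp := C.map Polynomial.C
  set Dp := D.map Polynomial.C
  set K := A.charmatrix
  -- Observability expresses `N` through `P` and `Q`, so it remains to find a Bezout identity for
  -- `Q` and `N`, which reachability provides.
  have hNG : N = Y₂.transpose * P - (Y₂.transpose * Dp + S₂.transpose * Bp) * Q := by
    have : Y₂.transpose * Cp * N = S₂.transpose * (Bp * Q) + N := by
      rw [h₂', Matrix.add_mul, Matrix.one_mul, Matrix.mul_assoc, hN]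
    rw [hP, Matrix.mul_add, ← Matrix.mul_assoc, this, Matrix.add_mul, Matrix.mul_assoc,
      Matrix.mul_assoc]
    abel
  obtain ⟨Wa, hWa⟩ := exists_eq_mul_of_reachKer_eq h.ker_eq (M := Y₁ * K) (S := S₁ * K + 1) (by
    change Bp * _ = K * _
    rw [← Matrix.mul_assoc, h₁]
    noncomm_ring)
  obtain ⟨Wb, hWb⟩ := exists_eq_mul_of_reachKer_eq h.ker_eq (M := 1 - Y₁ * Bp)
    (S := - (S₁ * Bp)) (by
      change Bp * _ = K * _
      rw [Matrix.mul_sub, ← Matrix.mul_assoc, h₁, Matrix.mul_one, Matrix.add_mul, Matrix.one_mul,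
        Matrix.mul_neg, Matrix.mul_assoc]
      abel)
  -- After multiplication by `Q` the left side is `(1 - Y₁ B) Q + Y₁ (X - A) N = Q`.
  have hone : Wb * Q + Wa * N = 1 := by
    apply hQ.mul_left_cancel
    rw [Matrix.mul_add, ← Matrix.mul_assoc, ← Matrix.mul_assoc]
    change Q * Wb * Q + Q * Wa * N = Q * 1
    rw [← hWb, ← hWa, Matrix.mul_assoc, hN, Matrix.sub_mul, Matrix.one_mul, Matrix.mul_one,
      Matrix.mul_assoc, sub_add_cancel]
  refine ⟨Matrix.fromCols (Wb - Wa * (Y₂.transpose * Dp + S₂.transpose * Bp))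
    (Wa * Y₂.transpose), ?_⟩
  rw [← Matrix.fromRows_toRows G, Matrix.fromCols_mul_fromRows]
  change _ * Q + _ * P = 1
  rw [← hone]
  conv_rhs => rw [hNG]
  rw [Matrix.mul_sub, Matrix.sub_mul, Matrix.mul_assoc, Matrix.mul_assoc]
  abel

/-- A state `x` reached by `v` gives a solution of `(X - A) a = χ x`. -/
lemma exists_charmatrix_mulVec_eq_charpoly_smul {Q : Matrix (Fin m) (Fin m) F[X]}
    (hker : reachKer A B = colSpan Q) {N : Matrix (Fin n) (Fin m) F[X]}
    (hN : A.charmatrix * N = B.map Polynomial.C * Q) (v : Fin m → F[X]) :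
    ∃ w s : _, Q.mulVec w = A.charpoly • v ∧
      A.charmatrix.mulVec (N.mulVec w - A.charpoly • s) =
        A.charpoly • constVec (reachMap A B v) := by
  have hv := charpoly_smul_mem_reachKer A B v
  rw [hker, mem_colSpan] at hv
  obtain ⟨w, hw⟩ := hv
  obtain ⟨s, hs⟩ := exists_charmatrix_mulVec_add A B v
  refine ⟨w, s, hw, ?_⟩
  rw [Matrix.mulVec_sub, Matrix.mulVec_mulVec, hN, ← Matrix.mulVec_mulVec, hw,
    Matrix.mulVec_smul, hs, Matrix.mulVec_smul, smul_add, add_sub_cancel_left]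

lemma Realizes.observable (h : Realizes A B C D G)
    (hG : IsRightPrime G) : Observable A B C D := by
  obtain ⟨N, hN, hP⟩ := h.transfer
  obtain ⟨Y, hY⟩ := hG
  rw [← Matrix.fromCols_toCols Y, ← Matrix.fromRows_toRows G,
    Matrix.fromCols_mul_fromRows] at hY
  set Q := G.toRows₁
  set P := G.toRows₂
  rw [observable_iff]
  intro x hx
  obtain ⟨v, rfl⟩ := (reachable_iff_surjective A B).1 h.reachable x
  obtain ⟨w, s, hw, ha⟩ := exists_charmatrix_mulVec_eq_charpoly_smul h.ker_eq hN v
  -- `a = χ (X - A)⁻¹ x` for the unobservable state `x` and `χ = A.charpoly`. Its coefficients lie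
  -- in the unobservable subspace `W`, so `C a = 0`.
  set a := N.mulVec w - A.charpoly • s with ha_def
  let W : Submodule F (Fin n → F) := ⨅ k : ℕ, LinearMap.ker (C * A ^ k).mulVecLin
  have hW : ∀ y, y ∈ W ↔ ∀ k, (C * A ^ k).mulVec y = 0 := fun y => by
    simp [W, Submodule.mem_iInf]
  have hCa : (C.map Polynomial.C).mulVec a = 0 := by
    have hmem := coeff_mem_of_charmatrix_mulVec_eq ha W (fun y hy => by
      rw [hW] at hy ⊢
      intro k
      rw [Matrix.mulVec_mulVec, Matrix.mul_assoc, ← pow_succ]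
      exact hy (k + 1)) (k₀ := 0) (fun k _ => by
        have : (fun i => ((A.charpoly • constVec (reachMap A B v)) i).coeff k) =
            A.charpoly.coeff k • reachMap A B v := by
          ext1 i
          simp
        rw [this]
        refine W.smul_mem _ ((hW _).2 fun l => ?_)
        rw [← Matrix.mulVec_mulVec]
        exact hx l)
    ext i k
    have := congrFun ((hW _).1 (hmem k (Nat.zero_le k)) 0) i
    simp only [pow_zero, Matrix.mul_one] at this
    simpa [Matrix.mulVec, dotProduct, finsetSum_coeff] using this
  have hNw : N.mulVec w = a + A.charpoly • s := by rw [ha_def, sub_add_cancel]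
  have hPw : P.mulVec w = A.charpoly •
      ((C.map Polynomial.C).mulVec s + (D.map Polynomial.C).mulVec v) := by
    rw [hP, Matrix.add_mulVec, ← Matrix.mulVec_mulVec, ← Matrix.mulVec_mulVec, hw, hNw,
      Matrix.mulVec_add, hCa, zero_add, Matrix.mulVec_smul, Matrix.mulVec_smul, smul_add]
  -- Both `Q w` and `P w` are divisible by `χ`, hence so is `w = Y G w`. Cancelling `χ` in `Q w = χ
  -- v` puts `v` into the kernel, so `x = 0`.
  obtain ⟨w', hw'⟩ : ∃ w', w = A.charpoly • w' := by
    refine ⟨Y.toCols₁.mulVec v + Y.toCols₂.mulVec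
      ((C.map Polynomial.C).mulVec s + (D.map Polynomial.C).mulVec v), ?_⟩
    rw [smul_add, ← Matrix.mulVec_smul, ← Matrix.mulVec_smul, ← hw, ← hPw, Matrix.mulVec_mulVec,
      Matrix.mulVec_mulVec, ← Matrix.add_mulVec, hY, Matrix.one_mulVec]
  rw [hw', Matrix.mulVec_smul] at hw
  have hQw : Q.mulVec w' = v := smul_right_injective _ A.charpoly_monic.ne_zero hw
  have : v ∈ reachKer A B := by
    rw [h.ker_eq]
    exact mem_colSpan.2 ⟨w', hQw⟩
  exact this

theorem Realizes.observable_iff_isRightPrime (h : Realizes A B C D G)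
    (hQ : IsKroneckerHermite G.toRows₁) : Observable A B C D ↔ IsRightPrime G :=
  ⟨h.isRightPrime hQ, h.observable⟩

end Realization

/-! ### The systems realizing a given matrix. -/

section Fibres

variable {F : Type*} [Field F] {n m p : ℕ}

/-- A row of `C N + D Q`. -/
noncomputable def rowMap (N : Matrix (Fin n) (Fin m) F[X]) (Q : Matrix (Fin m) (Fin m) F[X])
    (j : Fin m) : ((Fin n → F) × (Fin m → F)) →ₗ[F] F[X] where
  toFun cd := ∑ k, C (cd.1 k) * N k j + ∑ k, C (cd.2 k) * Q k j
  map_add' x y := by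
    simp only [Prod.fst_add, Prod.snd_add, Pi.add_apply, C_add, add_mul, Finset.sum_add_distrib]
    ring
  map_smul' a x := by
    simp only [Prod.smul_fst, Prod.smul_snd, Pi.smul_apply, smul_eq_mul, C_mul, mul_assoc,
      ← Finset.mul_sum, ← mul_add, RingHom.id_apply, smul_eq_C_mul]

lemma rowMap_apply (N : Matrix (Fin n) (Fin m) F[X]) (Q : Matrix (Fin m) (Fin m) F[X])
    (j : Fin m) (cd : (Fin n → F) × (Fin m → F)) :
    rowMap N Q j cd = ∑ k, C (cd.1 k) * N k j + ∑ k, C (cd.2 k) * Q k j := rfl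

variable {A : Matrix (Fin n) (Fin n) F} {B : Matrix (Fin n) (Fin m) F}
  {Q : Matrix (Fin m) (Fin m) F[X]} {N : Matrix (Fin n) (Fin m) F[X]}

lemma rowMap_mem_degreeLT (hQ : IsKroneckerHermite Q) (hN : A.charmatrix * N = B.map C * Q)
    (j : Fin m) (cd : (Fin n → F) × (Fin m → F)) :
    rowMap N Q j cd ∈ degreeLT F ((Q j j).natDegree + 1) := by
  rw [rowMap_apply]
  refine Submodule.add_mem _ (Submodule.sum_mem _ fun k _ => ?_)
    (Submodule.sum_mem _ fun k _ => ?_)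
  · rw [← smul_eq_C_mul]
    refine Submodule.smul_mem _ _ (mem_degreeLT.2 ?_)
    exact (degree_numerator_lt hQ hN k j).trans (by exact_mod_cast Nat.lt_succ_self _)
  · rw [← smul_eq_C_mul]
    refine Submodule.smul_mem _ _ (mem_degreeLT.2 ?_)
    exact lt_of_le_of_lt (hQ.natDegree_le j k) (by exact_mod_cast Nat.lt_succ_self _)

/-- In degree `deg Q_jj` the entry `j` sees only `Q`, since `N` has smaller column degrees. The
column leading coefficients of `Q` form a unipotent lower triangular matrix, so the row of `D`
vanishes from the last index backwards. -/
lemma snd_eq_zero_of_rowMap_eq_zero (hQ : IsKroneckerHermite Q)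
    (hN : A.charmatrix * N = B.map C * Q) {cd : (Fin n → F) × (Fin m → F)}
    (h : ∀ j, rowMap N Q j cd = 0) : cd.2 = 0 := by
  suffices hs : ∀ t (j : Fin m), m ≤ j + t → cd.2 j = 0 by
    ext1 j
    exact hs m j (Nat.le_add_left _ _)
  intro t
  induction t with
  | zero => exact fun j hj => absurd j.isLt (not_lt.2 hj)
  | succ t ih =>
    intro j hj
    have hc := congrArg (fun f => f.coeff (Q j j).natDegree) (h j)
    simp only [rowMap_apply, coeff_add, finsetSum_coeff, coeff_C_mul, coeff_zero] at hc
    rw [Finset.sum_eq_zero, zero_add, Finset.sum_eq_single j] at hc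
    · rwa [show (Q j j).coeff (Q j j).natDegree = 1 from hQ.monic_diag j, mul_one] at hc
    · intro k _ hkj
      rcases lt_or_gt_of_ne hkj with hlt | hgt
      · rw [coeff_eq_zero_of_degree_lt, mul_zero]
        rw [← degree_eq_natDegree (hQ.monic_diag j).ne_zero]
        exact hQ.col_above_lt j k hlt
      · rw [ih k (by have := Fin.lt_def.1 hgt; omega), zero_mul]
    · simp
    · intro k _
      rw [coeff_eq_zero_of_degree_lt (degree_numerator_lt hQ hN k j), mul_zero]

/-- For a state `x`, the vector `a = χ (X - A)⁻¹ x` has degree below `n` and equals `N w - χ s`. If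
`c N = 0`, then `c a` is a multiple of `χ` of degree below `n`, hence zero; its coefficient at `n -
1` is `c · x`. -/
lemma fst_eq_zero_of_sum_eq_zero (hr : Reachable A B) (hker : reachKer A B = colSpan Q)
    (hN : A.charmatrix * N = B.map C * Q) {c : Fin n → F}
    (h : ∀ j, ∑ k, C (c k) * N k j = 0) : c = 0 := by
  refine dotProduct_eq_zero c fun x => ?_
  rcases Nat.eq_zero_or_pos n with rfl | hn
  · simp [dotProduct]
  obtain ⟨v, rfl⟩ := (reachable_iff_surjective A B).1 hr x
  obtain ⟨w, s, -, ha⟩ := exists_charmatrix_mulVec_eq_charpoly_smul hker hN v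
  set x := reachMap A B v
  set a := N.mulVec w - A.charpoly • s with ha_def
  have hb : ∀ k, (fun i => ((A.charpoly • constVec x) i).coeff k) = A.charpoly.coeff k • x := by
    intro k
    ext1 i
    simp
  have hdeg : A.charpoly.natDegree = n := by
    rw [Matrix.charpoly_natDegree_eq_dim, Fintype.card_fin]
  have hcoeff : A.charpoly.coeff n = 1 := by
    have := A.charpoly_monic
    rwa [Monic, leadingCoeff, hdeg] at this
  have hlarge := coeff_mem_of_charmatrix_mulVec_eq ha ⊥
    (fun y hy => by rw [Submodule.mem_bot] at hy ⊢; rw [hy, Matrix.mulVec_zero]) (k₀ := n)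
    (fun k hk => by
      rw [hb, coeff_eq_zero_of_natDegree_lt (hdeg.trans_lt hk), zero_smul]
      exact Submodule.zero_mem _)
  have hzero : ∀ k, n ≤ k → ∀ i, (a i).coeff k = 0 := fun k hk i =>
    congrFun ((Submodule.mem_bot F).1 (hlarge k hk)) i
  -- Compare coefficients of `X^n` in `(X - A) a = χ x`, where `χ` is monic of degree `n` and `a`
  -- has no term of degree `n`.
  have hlead : ∀ i, (a i).coeff (n - 1) = x i := by
    intro i
    have := congrArg (fun f => f.coeff n) (congrFun ha i)
    rw [charmatrix_mulVec] at this
    simp only [Pi.sub_apply, Pi.smul_apply, smul_eq_mul, coeff_sub, Matrix.mulVec, dotProduct,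
      finsetSum_coeff, Matrix.map_apply, coeff_C_mul, hzero n le_rfl, mul_zero,
      Finset.sum_const_zero, sub_zero, constVec_apply, coeff_mul_C] at this
    rw [hcoeff, one_mul] at this
    rw [← this]
    obtain ⟨n', hn'⟩ := Nat.exists_eq_add_of_lt hn
    rw [hn', zero_add, Nat.add_sub_cancel, coeff_X_mul]
  have hca : ∑ i, C (c i) * a i = A.charpoly * - ∑ i, C (c i) * s i := by
    have hNw : ∑ i, C (c i) * N.mulVec w i = 0 := by
      simp only [Matrix.mulVec, dotProduct, Finset.mul_sum]
      rw [Finset.sum_comm]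
      refine Finset.sum_eq_zero fun j _ => ?_
      simp only [← mul_assoc]
      rw [← Finset.sum_mul, h j, zero_mul]
    have hterm : ∀ i, C (c i) * a i = C (c i) * N.mulVec w i - A.charpoly * (C (c i) * s i) := by
      intro i
      change C (c i) * (N.mulVec w i - A.charpoly * s i) = _
      rw [mul_sub, mul_left_comm]
    rw [Finset.sum_congr rfl fun i _ => hterm i, Finset.sum_sub_distrib, hNw, zero_sub,
      ← Finset.mul_sum, mul_neg]
  have hlt : (∑ i, C (c i) * a i).degree < A.charpoly.degree := by
    rw [degree_eq_natDegree A.charpoly_monic.ne_zero, hdeg, degree_lt_iff_coeff_zero]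
    intro k hk
    simp [finsetSum_coeff, hzero k hk]
  have hca0 : ∑ i, C (c i) * a i = 0 := by
    by_contra hne
    rw [hca] at hlt hne
    rw [degree_mul] at hlt
    have h0 : 0 ≤ (-∑ i, C (c i) * s i).degree := zero_le_degree_iff.2 (right_ne_zero_of_mul hne)
    exact absurd hlt (not_lt.2 (le_add_of_nonneg_right h0))
  have := congrArg (fun f => f.coeff (n - 1)) hca0
  simpa [finsetSum_coeff, hlead, dotProduct] using this

/-- For fixed `(A, B)`, every admissible row of the numerator comes from a unique pair of rows of
`C` and `D`. -/
lemma existsUnique_rowMap_eq (hQ : IsKroneckerHermite Q) (hr : Reachable A B)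
    (hker : reachKer A B = colSpan Q) (hdim : ∑ i, (Q i i).natDegree = n)
    (hN : A.charmatrix * N = B.map C * Q) (P : Fin m → F[X])
    (hP : ∀ j, (P j).degree ≤ (Q j j).natDegree) : ∃! cd, ∀ j, rowMap N Q j cd = P j := by
  let T : ((Fin n → F) × (Fin m → F)) →ₗ[F] Π j, degreeLT F ((Q j j).natDegree + 1) :=
    LinearMap.pi fun j => (rowMap N Q j).codRestrict _ (rowMap_mem_degreeLT hQ hN j)
  have hT : ∀ cd j, (T cd j : F[X]) = rowMap N Q j cd := fun _ _ => rfl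
  have hinj : Function.Injective T := by
    rw [← LinearMap.ker_eq_bot, LinearMap.ker_eq_bot']
    intro cd h
    have h0 : ∀ j, rowMap N Q j cd = 0 := fun j => by rw [← hT, h]; rfl
    have h2 := snd_eq_zero_of_rowMap_eq_zero hQ hN h0
    refine Prod.ext (fst_eq_zero_of_sum_eq_zero hr hker hN fun j => ?_) h2
    have := h0 j
    rw [rowMap_apply, h2] at this
    simpa using this
  -- Both dimensions are `n + m`, as `∑ (deg Q_jj + 1) = n + m`; injectivity thus gives
  -- surjectivity.
  have hfin : Module.finrank F ((Fin n → F) × (Fin m → F)) =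
      Module.finrank F (Π j, degreeLT F ((Q j j).natDegree + 1)) := by
    rw [Module.finrank_prod, Module.finrank_fin_fun, Module.finrank_fin_fun,
      Module.finrank_pi_fintype F (M := fun j => degreeLT F ((Q j j).natDegree + 1))]
    simp only [finrank_degreeLT, Finset.sum_add_distrib, hdim]
    simp
  have hsurj := (LinearMap.injective_iff_surjective_of_finrank_eq_finrank hfin).1 hinj
  have hPmem : ∀ j, P j ∈ degreeLT F ((Q j j).natDegree + 1) := fun j =>
    mem_degreeLT.2 (lt_of_le_of_lt (hP j) (by exact_mod_cast Nat.lt_succ_self _))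
  obtain ⟨cd, hcd⟩ := hsurj fun j => ⟨P j, hPmem j⟩
  refine ⟨cd, fun j => by rw [← hT, hcd], fun cd' h => hinj ?_⟩
  ext1 j
  apply Subtype.ext
  rw [hcd, hT]
  exact h j

lemma mul_add_mul_apply (C' : Matrix (Fin p) (Fin n) F) (D : Matrix (Fin p) (Fin m) F)
    (i : Fin p) (j : Fin m) :
    (C'.map C * N + D.map C * Q) i j = rowMap N Q j (C' i, D i) := by
  simp [rowMap_apply, Matrix.mul_apply]

lemma mem_matrixSet_iff {G : Matrix (Fin m ⊕ Fin p) (Fin m) F[X]} :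
    G ∈ matrixSet F p n m ↔ IsKroneckerHermite G.toRows₁ ∧
      ∑ i, (G.toRows₁ i i).natDegree = n ∧
      ∀ i j, (G.toRows₂ i j).degree ≤ (G.toRows₁ j j).natDegree := by
  refine and_congr_right fun hQ => and_congr ?_ ?_
  · rw [hQ.degree_det, Nat.cast_inj]
  · simp only [hQ.colDegree_eq]
    simp only [colDegree, Finset.sup_le_iff, Finset.mem_univ, true_imp_iff]
    exact forall_comm

lemma sum_natDegree_eq_of_reachKer_eq (hQ : IsKroneckerHermite Q) (hr : Reachable A B)
    (hker : reachKer A B = colSpan Q) : ∑ i, (Q i i).natDegree = n := by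
  have hk : LinearMap.ker (reachMap A B) = (colSpan Q).restrictScalars F := by
    ext v
    rw [Submodule.restrictScalars_mem, ← hker]
    rfl
  have e := (reachMap A B).quotKerEquivOfSurjective ((reachable_iff_surjective A B).1 hr)
  rw [← hQ.finrank_quotient, ← hk, e.finrank_eq, Module.finrank_fin_fun]

/-- Every reachable system is realized by exactly one element of `matrixSet`. -/
theorem existsUnique_realizes (hr : Reachable A B) (C' : Matrix (Fin p) (Fin n) F)
    (D : Matrix (Fin p) (Fin m) F) :
    ∃! G, G ∈ matrixSet F p n m ∧ Realizes A B C' D G := by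
  obtain ⟨Q, hQ, hspan⟩ := exists_isKroneckerHermite (reachKer A B) A.charpoly_monic
    (charpoly_smul_mem_reachKer A B)
  obtain ⟨N, hN⟩ := exists_numerator hspan.symm
  refine ⟨Matrix.fromRows Q (C'.map C * N + D.map C * Q), ⟨?_, ?_⟩, ?_⟩
  · rw [mem_matrixSet_iff, Matrix.toRows₁_fromRows, Matrix.toRows₂_fromRows]
    refine ⟨hQ, sum_natDegree_eq_of_reachKer_eq hQ hr hspan.symm, fun i j => ?_⟩
    rw [mul_add_mul_apply]
    have := mem_degreeLT.1 (rowMap_mem_degreeLT hQ hN j (C' i, D i))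
    rw [degree_le_iff_coeff_zero]
    intro l hl
    refine coeff_eq_zero_of_degree_lt (lt_of_lt_of_le this ?_)
    exact_mod_cast Nat.succ_le_of_lt (by exact_mod_cast hl)
  · exact ⟨hr, by rw [Matrix.toRows₁_fromRows, hspan], N,
      by rw [Matrix.toRows₁_fromRows, hN], by rw [Matrix.toRows₁_fromRows, Matrix.toRows₂_fromRows]⟩
  · rintro G ⟨hG, hG'⟩
    obtain ⟨hGQ, -, -⟩ := hG
    obtain ⟨N', hN', hP⟩ := hG'.transfer
    have hQQ : G.toRows₁ = Q := hGQ.eq_of_colSpan_eq hQ (by rw [hspan, hG'.ker_eq])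
    rw [hQQ] at hN' hP
    have hNN : N' = N := charmatrix_mul_left_cancel (hN'.trans hN.symm)
    rw [← Matrix.fromRows_toRows G, hQQ, hP, hNN]

lemma existsUnique_output {G : Matrix (Fin m ⊕ Fin p) (Fin m) F[X]}
    (hG : G ∈ matrixSet F p n m) (hr : Reachable A B) (hker : reachKer A B = colSpan G.toRows₁) :
    ∃! CD : Matrix (Fin p) (Fin n) F × Matrix (Fin p) (Fin m) F, Realizes A B CD.1 CD.2 G := by
  obtain ⟨hQ, hdim, hP⟩ := mem_matrixSet_iff.1 hG
  obtain ⟨N, hN⟩ := exists_numerator hker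
  have hex := fun i => existsUnique_rowMap_eq hQ hr hker hdim hN (G.toRows₂ i) (hP i)
  choose cd hcd huniq using hex
  refine ⟨(Matrix.of fun i => (cd i).1, Matrix.of fun i => (cd i).2), ⟨hr, hker, N, hN, ?_⟩, ?_⟩
  · ext1 i j
    rw [mul_add_mul_apply]
    exact (hcd i j).symm
  · rintro ⟨C', D⟩ h
    obtain ⟨N', hN', hP'⟩ := h.transfer
    have hNN : N' = N := charmatrix_mul_left_cancel (hN'.trans hN.symm)
    have : ∀ i, (C' i, D i) = cd i := fun i => huniq i _ fun j => by
      rw [← mul_add_mul_apply, ← hNN]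
      exact (congrFun (congrFun hP' i) j).symm
    refine Prod.ext ?_ ?_
    · ext1 i j
      exact congrFun (congrArg Prod.fst (this i)) j
    · ext1 i j
      exact congrFun (congrArg Prod.snd (this i)) j

lemma matrix_eq_of_mulVec_eq {A A' : Matrix (Fin n) (Fin m) F}
    (h : ∀ x, A.mulVec x = A'.mulVec x) : A = A' :=
  Matrix.mulVec_injective (funext h)

/-- `B` is recovered from constant inputs and `A` from multiplication by `X`, the latter on all
states by reachability. -/
lemma reachMap_injective {A A' : Matrix (Fin n) (Fin n) F} {B B' : Matrix (Fin n) (Fin m) F}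
    (hr : Reachable A B) (h : reachMap A B = reachMap A' B') : A = A' ∧ B = B' := by
  constructor
  · refine matrix_eq_of_mulVec_eq fun x => ?_
    obtain ⟨v, rfl⟩ := (reachable_iff_surjective A B).1 hr x
    conv_rhs => rw [h]
    rw [← reachMap_X_smul, ← reachMap_X_smul, h]
  · exact matrix_eq_of_mulVec_eq fun u => by rw [← reachMap_const A B, h, reachMap_const]

/-- A surjection whose kernel is an `F[X]`-submodule is some `reachMap`. -/
lemma exists_reachMap_eq (V : Submodule F[X] (Fin m → F[X]))
    (ψ : (Fin m → F[X]) →ₗ[F] (Fin n → F)) (hψ : Function.Surjective ψ)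
    (hker : ∀ v, ψ v = 0 ↔ v ∈ V) :
    ∃ (A : Matrix (Fin n) (Fin n) F) (B : Matrix (Fin n) (Fin m) F), reachMap A B = ψ := by
  obtain ⟨σ, hσ⟩ := ψ.exists_rightInverse_of_surjective (LinearMap.range_eq_top.2 hψ)
  have hσ' : ∀ x, ψ (σ x) = x := fun x => LinearMap.congr_fun hσ x
  let cst : (Fin m → F) →ₗ[F] (Fin m → F[X]) :=
    { toFun := constVec
      map_add' := constVec_add
      map_smul' := fun c x => by ext1; simp [smul_eq_C_mul] }
  let shift : (Fin m → F[X]) →ₗ[F] (Fin m → F[X]) :=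
    { toFun := fun v => (X : F[X]) • v
      map_add' := smul_add _
      map_smul' := fun c x => smul_comm _ _ _ }
  -- The kernel is stable under `X`, so the induced action on `F^n` does not depend on the section
  -- `σ`.
  have hshift : ∀ v, ψ (shift (σ (ψ v))) = ψ (shift v) := by
    intro v
    rw [← sub_eq_zero, ← map_sub, ← map_sub, hker]
    refine V.smul_mem _ ?_
    rw [← hker, map_sub, hσ', sub_self]
  refine ⟨LinearMap.toMatrix' (ψ ∘ₗ shift ∘ₗ σ), LinearMap.toMatrix' (ψ ∘ₗ cst), ?_⟩
  refine LinearMap.ext fun v => ?_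
  induction v using polyVec_induction with
  | h0 => simp
  | step v u ih =>
    rw [map_add, map_add, reachMap_X_smul, reachMap_const, LinearMap.toMatrix'_mulVec,
      LinearMap.toMatrix'_mulVec, ih]
    congr 1
    exact hshift v

/-- The pairs `(A, B)` with prescribed kernel correspond to the automorphisms of the state
space. -/
lemma card_reachable_with_ker (hQ : IsKroneckerHermite Q) (hdim : ∑ i, (Q i i).natDegree = n) :
    Nat.card {s : Matrix (Fin n) (Fin n) F × Matrix (Fin n) (Fin m) F //
      Reachable s.1 s.2 ∧ reachKer s.1 s.2 = colSpan Q} =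
    Nat.card ((Fin n → F) ≃ₗ[F] (Fin n → F)) := by
  set V := colSpan Q with hV
  have := hQ.finite_quotient
  let e₀ : ((Fin m → F[X]) ⧸ V.restrictScalars F) ≃ₗ[F] (Fin n → F) :=
    LinearEquiv.ofFinrankEq _ _ (by rw [hQ.finrank_quotient, hdim, Module.finrank_fin_fun])
  let ψ : (Fin m → F[X]) →ₗ[F] (Fin n → F) := e₀.toLinearMap ∘ₗ (V.restrictScalars F).mkQ
  have hψ : Function.Surjective ψ := e₀.surjective.comp (Submodule.mkQ_surjective _)
  have hψker : ∀ v, ψ v = 0 ↔ v ∈ V := fun v => by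
    change e₀ (Submodule.mkQ _ v) = 0 ↔ _
    rw [e₀.map_eq_zero_iff]
    exact Submodule.Quotient.mk_eq_zero _
  have hex : ∀ T : (Fin n → F) ≃ₗ[F] (Fin n → F),
      ∃ s : Matrix (Fin n) (Fin n) F × Matrix (Fin n) (Fin m) F,
        reachMap s.1 s.2 = T.toLinearMap ∘ₗ ψ := fun T => by
    obtain ⟨A, B, h⟩ := exists_reachMap_eq V (T.toLinearMap ∘ₗ ψ) (T.surjective.comp hψ)
      fun v => by
        change T (ψ v) = 0 ↔ _
        rw [T.map_eq_zero_iff, hψker]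
    exact ⟨(A, B), h⟩
  choose s hs using hex
  have hsr : ∀ T, Reachable (s T).1 (s T).2 := fun T => by
    rw [reachable_iff_surjective, hs]
    exact T.surjective.comp hψ
  have hsk : ∀ T, reachKer (s T).1 (s T).2 = V := fun T => by
    ext v
    rw [mem_reachKer, hs]
    change T (ψ v) = 0 ↔ _
    rw [T.map_eq_zero_iff, hψker]
  symm
  refine Nat.card_congr (Equiv.ofBijective (fun T => ⟨s T, hsr T, hsk T⟩) ⟨?_, ?_⟩)
  · intro T T' h
    have h1 : s T = s T' := congrArg Subtype.val h
    have h2 : T.toLinearMap ∘ₗ ψ = T'.toLinearMap ∘ₗ ψ := by rw [← hs, ← hs, h1]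
    ext1 x
    obtain ⟨v, rfl⟩ := hψ x
    exact LinearMap.congr_fun h2 v
  · rintro ⟨⟨A, B⟩, hr, hk⟩
    have hsurj := (reachable_iff_surjective A B).1 hr
    have hk' : LinearMap.ker (reachMap A B) = V.restrictScalars F := by
      ext v
      rw [Submodule.restrictScalars_mem, ← hk]
      rfl
    -- `T` compares the two identifications of the quotient by `V` with `F^n`, given by `e₀` and by
    -- `(A, B)`.
    let T : (Fin n → F) ≃ₗ[F] (Fin n → F) :=
      e₀.symm ≪≫ₗ (Submodule.quotEquivOfEq _ _ hk'.symm) ≪≫ₗ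
        (reachMap A B).quotKerEquivOfSurjective hsurj
    have hT : T.toLinearMap ∘ₗ ψ = reachMap A B := by
      refine LinearMap.ext fun v => ?_
      simp only [T, ψ, LinearMap.comp_apply, LinearEquiv.coe_coe, LinearEquiv.trans_apply,
        LinearEquiv.symm_apply_apply]
      rfl
    obtain ⟨h1, h2⟩ := reachMap_injective (hsr T) ((hs T).trans hT)
    exact ⟨T, Subtype.ext (Prod.ext h1 h2)⟩

/-- Every element of `matrixSet` is realized by the same number of systems. -/
theorem card_realizes {G : Matrix (Fin m ⊕ Fin p) (Fin m) F[X]} (hG : G ∈ matrixSet F p n m) :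
    Nat.card {s : Matrix (Fin n) (Fin n) F × Matrix (Fin n) (Fin m) F ×
      Matrix (Fin p) (Fin n) F × Matrix (Fin p) (Fin m) F //
        Realizes s.1 s.2.1 s.2.2.1 s.2.2.2 G} =
    Nat.card ((Fin n → F) ≃ₗ[F] (Fin n → F)) := by
  obtain ⟨hQ, hdim, -⟩ := mem_matrixSet_iff.1 hG
  rw [← card_reachable_with_ker hQ hdim]
  refine Nat.card_congr (Equiv.ofBijective
    (fun s => ⟨(s.1.1, s.1.2.1), s.2.reachable, s.2.ker_eq⟩) ⟨?_, ?_⟩)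
  · rintro ⟨⟨A, B, C₁, D₁⟩, h⟩ ⟨⟨A', B', C₂, D₂⟩, h'⟩ heq
    obtain ⟨rfl, rfl⟩ : A = A' ∧ B = B' := by simpa using heq
    have := (existsUnique_output hG h.reachable h.ker_eq).unique (y₁ := (C₁, D₁))
      (y₂ := (C₂, D₂)) h h'
    obtain ⟨rfl, rfl⟩ := Prod.mk.inj this
    rfl
  · rintro ⟨⟨A, B⟩, hr, hk⟩
    obtain ⟨⟨C', D⟩, h, -⟩ := existsUnique_output hG hr hk
    exact ⟨⟨(A, B, C', D), h⟩, rfl⟩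

end Fibres

/-! ### Counting reachable pairs over a finite field. -/

section Counting

universe u v

variable {F : Type u} [Field F]

/-- `W` generates `V` under the action of `A`. -/
def Generates {V : Type*} [AddCommGroup V] [Module F V] (A : V →ₗ[F] V) (W : Submodule F V) :
    Prop :=
  ∀ S : Submodule F V, W ≤ S → (∀ x ∈ S, A x ∈ S) → S = ⊤

lemma generates_conj {V V' : Type*} [AddCommGroup V] [Module F V] [AddCommGroup V'] [Module F V']
    (e : V ≃ₗ[F] V') (A : V →ₗ[F] V) (W : Submodule F V) (h : Generates A W) :
    Generates (e.conj A) (W.map e.toLinearMap) := by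
  intro S hW hA
  have := h (S.comap e.toLinearMap) (Submodule.map_le_iff_le_comap.1 hW) fun x hx => by
    have := hA _ hx
    rw [LinearEquiv.conj_apply_apply] at this
    simpa using this
  rw [eq_top_iff]
  rintro y -
  have hy : e.symm y ∈ S.comap e.toLinearMap := by rw [this]; trivial
  simpa using hy

lemma generates_conj_iff {V V' : Type*} [AddCommGroup V] [Module F V] [AddCommGroup V']
    [Module F V'] (e : V ≃ₗ[F] V') (A : V →ₗ[F] V) (W : Submodule F V) :
    Generates (e.conj A) (W.map e.toLinearMap) ↔ Generates A W := by
  refine ⟨fun h => ?_, generates_conj e A W⟩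
  have hA : e.symm.conj (e.conj A) = A := by
    ext x
    simp
  have := generates_conj e.symm _ _ h
  rwa [← Submodule.map_comp, LinearEquiv.comp_coe, LinearEquiv.self_trans_symm,
    LinearEquiv.refl_toLinearMap, Submodule.map_id, hA] at this

section Product

variable {W U E : Type*} [AddCommGroup W] [Module F W] [AddCommGroup U] [Module F U]
  [AddCommGroup E] [Module F E]

/-- A subspace containing `W × 0` has the form `W × S`, and its invariance involves only the blocks
of `M` into `U`. The blocks into `W` remain free. -/
lemma generates_range_inl_iff (M : (W × U) →ₗ[F] (W × U)) :
    Generates M (LinearMap.range (LinearMap.inl F W U)) ↔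
      Generates (LinearMap.snd F W U ∘ₗ M ∘ₗ LinearMap.inr F W U)
        (LinearMap.range (LinearMap.snd F W U ∘ₗ M ∘ₗ LinearMap.inl F W U)) := by
  have hdec : ∀ (S : Submodule F (W × U)), LinearMap.range (LinearMap.inl F W U) ≤ S →
      ∀ w u, (w, u) ∈ S ↔ ((0 : W), u) ∈ S := by
    intro S hS w u
    have hw : (w, (0 : U)) ∈ S := hS ⟨w, rfl⟩
    constructor
    · intro h
      simpa using S.sub_mem h hw
    · intro h
      simpa using S.add_mem hw h
  constructor
  · intro h S hS hA
    have := h (S.comap (LinearMap.snd F W U)) (by rintro _ ⟨w, rfl⟩; simp) (by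
      rintro ⟨w, u⟩ hu
      have hu' : u ∈ S := hu
      have h1 : M (w, u) = M (LinearMap.inl F W U w) + M (LinearMap.inr F W U u) := by
        rw [← map_add]; simp
      change (M (w, u)).2 ∈ S
      rw [h1]
      exact S.add_mem (hS ⟨w, rfl⟩) (hA u hu'))
    rw [eq_top_iff]
    rintro u -
    have hu : ((0 : W), u) ∈ S.comap (LinearMap.snd F W U) := by rw [this]; trivial
    exact hu
  · intro h S hS hA
    have := h (S.comap (LinearMap.inr F W U)) (by
      rintro _ ⟨w, rfl⟩
      have := hA (LinearMap.inl F W U w) (hS ⟨w, rfl⟩)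
      exact (hdec S hS (M (LinearMap.inl F W U w)).1 _).1 this) (by
      intro u hu
      have := hA (LinearMap.inr F W U u) hu
      exact (hdec S hS (M (LinearMap.inr F W U u)).1 _).1 this)
    rw [eq_top_iff]
    rintro ⟨w, u⟩ -
    have hu : u ∈ S.comap (LinearMap.inr F W U) := by rw [this]; trivial
    exact (hdec S hS w u).2 hu

lemma range_inl_sup_range_eq_top_iff (f : E →ₗ[F] (W × U)) :
    LinearMap.range (LinearMap.inl F W U) ⊔ LinearMap.range f = ⊤ ↔
      Function.Surjective (LinearMap.snd F W U ∘ₗ f) := by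
  constructor
  · intro h u
    have : ((0 : W), u) ∈ LinearMap.range (LinearMap.inl F W U) ⊔ LinearMap.range f := by
      rw [h]; trivial
    obtain ⟨_, ⟨w, rfl⟩, _, ⟨x, rfl⟩, hx⟩ := Submodule.mem_sup.1 this
    exact ⟨x, by simpa using congrArg Prod.snd hx⟩
  · intro h
    rw [eq_top_iff]
    rintro ⟨w, u⟩ -
    obtain ⟨x, hx⟩ := h u
    refine Submodule.mem_sup.2 ⟨_, ⟨w - (f x).1, rfl⟩, _, ⟨x, rfl⟩, ?_⟩
    have hx' : (f x).2 = u := hx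
    ext <;> simp [hx']

/-- The four blocks of an endomorphism of a product. -/
noncomputable def endProdEquiv : ((W × U) →ₗ[F] (W × U)) ≃
    ((W →ₗ[F] W) × (U →ₗ[F] W)) × ((U →ₗ[F] U) × (W →ₗ[F] U)) where
  toFun M := ((LinearMap.fst F W U ∘ₗ M ∘ₗ LinearMap.inl F W U,
      LinearMap.fst F W U ∘ₗ M ∘ₗ LinearMap.inr F W U),
    (LinearMap.snd F W U ∘ₗ M ∘ₗ LinearMap.inr F W U,
      LinearMap.snd F W U ∘ₗ M ∘ₗ LinearMap.inl F W U))
  invFun x := (x.1.1.coprod x.1.2).prod (x.2.2.coprod x.2.1)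
  left_inv M := by
    ext <;> simp [Prod.mk_zero_zero]
  right_inv x := by
    obtain ⟨⟨a, b⟩, c, d⟩ := x
    refine Prod.ext (Prod.ext ?_ ?_) (Prod.ext ?_ ?_) <;> ext <;> simp

end Product

lemma card_subtype_snd {α β : Type*} (P : β → Prop) :
    Nat.card {x : α × β // P x.2} = Nat.card α * Nat.card {y : β // P y} := by
  rw [← Nat.card_prod]
  exact Nat.card_congr
    { toFun := fun x => (x.1.1, ⟨x.1.2, x.2⟩)
      invFun := fun y => ⟨(y.1, y.2.1), y.2.2⟩
      left_inv := fun _ => rfl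
      right_inv := fun _ => rfl }

lemma card_prod_subtype {α β : Type*} [Fintype α] [Finite β] (P : α → β → Prop) :
    Nat.card {x : β × α // P x.2 x.1} = ∑ a, Nat.card {b : β // P a b} := by
  rw [← Nat.card_sigma]
  exact Nat.card_congr
    { toFun := fun x => ⟨x.1.2, x.1.1, x.2⟩
      invFun := fun y => ⟨(y.2.1, y.1), y.2.2⟩
      left_inv := fun _ => rfl
      right_inv := fun _ => rfl }

/-- The number of surjections from an `N`-dimensional to an `n`-dimensional space over a field with
`q` elements. -/
def surjCount (q n N : ℕ) : ℕ := ∏ i : Fin n, (q ^ N - q ^ (i : ℕ))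

lemma surjCount_eq_zero {q n N : ℕ} (h : N < n) : surjCount q n N = 0 :=
  Finset.prod_eq_zero (Finset.mem_univ ⟨N, h⟩) (Nat.sub_self _)

/-- A proper range is killed by a nonzero functional on `F^n`, that is, by a linear relation among
the `φ i`. This turns surjections into independent families. -/
lemma surjective_pi_iff {E : Type*} [AddCommGroup E] [Module F E] {n : ℕ}
    (φ : Fin n → (E →ₗ[F] F)) :
    Function.Surjective (LinearMap.pi φ) ↔ LinearIndependent F φ := by
  rw [Fintype.linearIndependent_iff]
  have hdot : ∀ (c : Fin n → F) x, c ⬝ᵥ LinearMap.pi φ x = (∑ i, c i • φ i) x := fun c x => by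
    simp [dotProduct]
  constructor
  · intro h c hc
    refine congrFun (dotProduct_eq_zero c fun y => ?_)
    obtain ⟨x, rfl⟩ := h y
    rw [hdot, hc, LinearMap.zero_apply]
  · intro h
    rw [← LinearMap.range_eq_top]
    by_contra hne
    obtain ⟨f, hf0, hf⟩ := Submodule.exists_le_ker_of_lt_top _ (lt_top_iff_ne_top.2 hne)
    obtain ⟨c, rfl⟩ := (dotProductEquiv F (Fin n)).surjective f
    refine hf0 ?_
    have : c = 0 := funext <| h c <| LinearMap.ext fun x => by
      rw [← hdot]
      exact LinearMap.mem_ker.1 (hf ⟨x, rfl⟩)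
    rw [this, map_zero]

lemma card_linearMap (E V : Type*) [AddCommGroup E] [Module F E] [Module.Finite F E]
    [AddCommGroup V] [Module F V] [Module.Finite F V] :
    Nat.card (E →ₗ[F] V) = Nat.card F ^ (Module.finrank F E * Module.finrank F V) := by
  rw [Module.natCard_eq_pow_finrank (K := F), Module.finrank_linearMap]

lemma card_generates_of_isCompl {V : Type*} [AddCommGroup V] [Module F V] [Module.Finite F V]
    {W U : Submodule F V} (h : IsCompl W U) :
    Nat.card {A : V →ₗ[F] V // Generates A W} =
      Nat.card F ^ (Module.finrank F W * Module.finrank F V) *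
        Nat.card {x : (U →ₗ[F] U) × (W →ₗ[F] U) // Generates x.1 (LinearMap.range x.2)} := by
  let e : (W × U) ≃ₗ[F] V := Submodule.prodEquivOfIsCompl W U h
  have he : (LinearMap.range (LinearMap.inl F W U)).map e.toLinearMap = W := by
    ext x
    constructor
    · rintro ⟨_, ⟨w, rfl⟩, rfl⟩
      simp [e]
    · intro hx
      exact ⟨_, ⟨⟨x, hx⟩, rfl⟩, by simp [e]⟩
  have h1 : Nat.card {A : V →ₗ[F] V // Generates A W} =
      Nat.card {x : ((W →ₗ[F] W) × (U →ₗ[F] W)) × ((U →ₗ[F] U) × (W →ₗ[F] U)) //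
        Generates x.2.1 (LinearMap.range x.2.2)} := by
    symm
    refine Nat.card_congr (Equiv.subtypeEquiv
      (endProdEquiv.symm.trans e.conj.toEquiv) fun x => ?_)
    obtain ⟨M, rfl⟩ := endProdEquiv.surjective x
    rw [Equiv.trans_apply, Equiv.symm_apply_apply]
    have h2 := generates_conj_iff e M (LinearMap.range (LinearMap.inl F W U))
    rw [he] at h2
    exact (generates_range_inl_iff M).symm.trans h2.symm
  rw [h1, card_subtype_snd (fun x : (U →ₗ[F] U) × (W →ₗ[F] U) =>
    Generates x.1 (LinearMap.range x.2)), Nat.card_prod, card_linearMap, card_linearMap, ← pow_add,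
    ← Submodule.finrank_add_eq_of_isCompl h]
  congr 2
  ring

variable [Finite F]

theorem card_surjective (E V : Type*) [AddCommGroup E] [Module F E] [Module.Finite F E]
    [AddCommGroup V] [Module F V] [Module.Finite F V] :
    Nat.card {f : E →ₗ[F] V // Function.Surjective f} =
      surjCount (Nat.card F) (Module.finrank F V) (Module.finrank F E) := by
  have := Fintype.ofFinite F
  set n := Module.finrank F V
  let e : V ≃ₗ[F] (Fin n → F) := LinearEquiv.ofFinrankEq _ _ (by simp [n])
  have h1 : Nat.card {f : E →ₗ[F] V // Function.Surjective f} =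
      Nat.card {φ : Fin n → (E →ₗ[F] F) // LinearIndependent F φ} := by
    refine Nat.card_congr (Equiv.subtypeEquiv
      { toFun := fun f i => LinearMap.proj i ∘ₗ e.toLinearMap ∘ₗ f
        invFun := fun φ => e.symm.toLinearMap ∘ₗ LinearMap.pi φ
        left_inv := fun f => by
          refine LinearMap.ext fun x => ?_
          exact e.symm_apply_apply (f x)
        right_inv := fun φ => by
          ext i x
          simp } fun f => ?_)
    rw [← surjective_pi_iff]
    have : LinearMap.pi (fun i => LinearMap.proj i ∘ₗ e.toLinearMap ∘ₗ f) =
        e.toLinearMap ∘ₗ f := rfl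
    change _ ↔ Function.Surjective (LinearMap.pi (fun i => LinearMap.proj i ∘ₗ e.toLinearMap ∘ₗ f))
    rw [this, LinearMap.coe_comp]
    exact (EquivLike.comp_surjective _ e).symm
  have hfr : Module.finrank F (E →ₗ[F] F) = Module.finrank F E := by
    rw [Module.finrank_linearMap, Module.finrank_self, mul_one]
  have : Finite (E →ₗ[F] F) := Module.finite_of_finite F
  rw [h1]
  rcases le_or_gt n (Module.finrank F E) with h | h
  · rw [card_linearIndependent (by rwa [hfr]), hfr, surjCount, Nat.card_eq_fintype_card]
  · rw [surjCount_eq_zero h, Nat.card_eq_zero]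
    left
    refine ⟨fun φ => ?_⟩
    have := φ.2.fintype_card_le_finrank
    rw [hfr, Fintype.card_fin] at this
    omega

lemma card_sup_range_eq_top_of_isCompl (E : Type*) [AddCommGroup E] [Module F E]
    [Module.Finite F E] {V : Type*} [AddCommGroup V] [Module F V] [Module.Finite F V]
    {W U : Submodule F V} (h : IsCompl W U) :
    Nat.card {f : E →ₗ[F] V // W ⊔ LinearMap.range f = ⊤} =
      Nat.card F ^ (Module.finrank F E * Module.finrank F W) *
        surjCount (Nat.card F) (Module.finrank F U) (Module.finrank F E) := by
  let e : (W × U) ≃ₗ[F] V := Submodule.prodEquivOfIsCompl W U h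
  have he : (LinearMap.range (LinearMap.inl F W U)).map e.toLinearMap = W := by
    ext x
    constructor
    · rintro ⟨_, ⟨w, rfl⟩, rfl⟩
      simp [e]
    · intro hx
      exact ⟨_, ⟨⟨x, hx⟩, rfl⟩, by simp [e]⟩
  have h1 : Nat.card {f : E →ₗ[F] V // W ⊔ LinearMap.range f = ⊤} =
      Nat.card {x : (E →ₗ[F] W) × (E →ₗ[F] U) // Function.Surjective x.2} := by
    symm
    refine Nat.card_congr (Equiv.subtypeEquiv
      ((LinearMap.prodEquiv F).toEquiv.trans ((LinearEquiv.refl F E).arrowCongr e).toEquiv) fun x => ?_)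
    have h2 := range_inl_sup_range_eq_top_iff (x.1.prod x.2)
    rw [LinearMap.snd_prod] at h2
    rw [← h2]
    change _ ↔ W ⊔ LinearMap.range (e.toLinearMap ∘ₗ x.1.prod x.2) = ⊤
    have h3 : W ⊔ LinearMap.range (e.toLinearMap ∘ₗ x.1.prod x.2) =
        (LinearMap.range (LinearMap.inl F W U) ⊔ LinearMap.range (x.1.prod x.2)).map
          e.toLinearMap := by
      rw [Submodule.map_sup, he, LinearMap.range_comp]
    rw [h3]
    constructor
    · intro h
      rw [h, Submodule.map_top, LinearEquiv.range]
    · intro h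
      exact Submodule.map_injective_of_injective e.injective
        (by rw [h, Submodule.map_top, LinearEquiv.range])
  rw [h1, card_subtype_snd (fun x : E →ₗ[F] U => Function.Surjective x), card_linearMap,
    card_surjective]

/-- The number of pairs `(A, B)` such that the range of `B` generates `V` under `A`. -/
theorem card_generates (n : ℕ) : ∀ (V E : Type v) [AddCommGroup V] [Module F V]
    [Module.Finite F V] [AddCommGroup E] [Module F E] [Module.Finite F E],
    Module.finrank F V = n →
    Nat.card {x : (V →ₗ[F] V) × (E →ₗ[F] V) // Generates x.1 (LinearMap.range x.2)} =
      Nat.card F ^ n * surjCount (Nat.card F) n (Module.finrank F E + n - 1) := by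
  induction n using Nat.strong_induction_on with
  | _ n ih =>
    intro V E _ _ _ _ _ _ hV
    have : Finite (V →ₗ[F] V) := Module.finite_of_finite F
    have : Finite (E →ₗ[F] V) := Module.finite_of_finite F
    have : Fintype (E →ₗ[F] V) := Fintype.ofFinite _
    rcases Nat.eq_zero_or_pos n with rfl | hn
    · have hsub : Subsingleton V := Module.finrank_zero_iff.1 hV
      have : Unique {x : (V →ₗ[F] V) × (E →ₗ[F] V) // Generates x.1 (LinearMap.range x.2)} :=
        { default := ⟨0, fun S _ _ => Subsingleton.elim _ _⟩
          uniq := fun x => Subsingleton.elim _ _ }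
      rw [Nat.card_unique]
      simp [surjCount]
    have hfin : Finite ((Fin (n - 1) → F) →ₗ[F] V) := Module.finite_of_finite F
    -- With `W` the range of `B` and `U` a complement, the induction hypothesis for `(U, W)` yields
    -- `surjCount` at `(dim U, n - 1)`. The same number counts maps from an auxiliary `F^(n-1)` that
    -- together with `B` span `V`, up to powers of `q`.
    have key : ∀ B : E →ₗ[F] V, Nat.card {A : V →ₗ[F] V // Generates A (LinearMap.range B)} =
        Nat.card F ^ n * Nat.card {f : (Fin (n - 1) → F) →ₗ[F] V //
          LinearMap.range B ⊔ LinearMap.range f = ⊤} := by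
      intro B
      obtain ⟨U, hU⟩ := (LinearMap.range B).exists_isCompl
      have hdim := Submodule.finrank_add_eq_of_isCompl hU
      rw [card_generates_of_isCompl hU, card_sup_range_eq_top_of_isCompl _ hU]
      set W := LinearMap.range B
      rw [hV] at hdim ⊢
      rw [Module.finrank_fin_fun]
      -- If `B = 0` the dimension does not drop and induction is unavailable, but then both sides
      -- vanish, as `n - 1 < n`.
      rcases Nat.eq_zero_or_pos (Module.finrank F W) with hW | hW
      · have hUn : Module.finrank F U = n := by omega
        rw [hUn, surjCount_eq_zero (Nat.sub_lt hn one_pos), mul_zero, mul_zero, mul_eq_zero]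
        right
        rw [Nat.card_eq_zero]
        left
        refine ⟨fun x => ?_⟩
        have hWs : Subsingleton W := Module.finrank_zero_iff.1 hW
        have h0 := x.2 ⊥ (by
          rintro _ ⟨w, rfl⟩
          rw [Subsingleton.elim w 0, map_zero]
          exact Submodule.zero_mem _) (fun y hy => by
            rw [Submodule.mem_bot] at hy ⊢
            rw [hy, map_zero])
        have : Module.finrank F U = 0 := by
          rw [← finrank_top, ← h0, finrank_bot]
        omega
      · rw [ih (Module.finrank F U) (by omega) U W rfl,
          show Module.finrank F W + Module.finrank F U - 1 = n - 1 by omega, ← mul_assoc,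
          ← mul_assoc, ← pow_add, ← pow_add]
        congr 2
        obtain ⟨k, rfl⟩ : ∃ k, n = k + 1 := ⟨n - 1, by omega⟩
        rw [Nat.add_sub_cancel]
        nlinarith
    -- Pairs `(B, f)` whose ranges together span `V` are the surjections from `E × F^(n-1)` onto
    -- `V`.
    have hsurj : ∑ B : E →ₗ[F] V, Nat.card {f : (Fin (n - 1) → F) →ₗ[F] V //
        LinearMap.range B ⊔ LinearMap.range f = ⊤} =
        surjCount (Nat.card F) n (Module.finrank F E + n - 1) := by
      rw [← card_prod_subtype]
      have hfr : Module.finrank F (E × (Fin (n - 1) → F)) = Module.finrank F E + n - 1 := by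
        rw [Module.finrank_prod, Module.finrank_fin_fun]
        omega
      rw [← hfr, ← hV, ← card_surjective]
      refine Nat.card_congr (Equiv.subtypeEquiv
        ((Equiv.prodComm _ _).trans (LinearMap.coprodEquiv F).toEquiv) fun x => ?_)
      rw [← LinearMap.range_eq_top]
      change _ ↔ LinearMap.range (x.2.coprod x.1) = ⊤
      rw [LinearMap.range_coprod]
    rw [card_prod_subtype (fun (B : E →ₗ[F] V) A => Generates A (LinearMap.range B)),
      Finset.sum_congr rfl fun B _ => key B, ← Finset.mul_sum, hsurj]

theorem card_reachable (n m : ℕ) :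
    Nat.card {s : Matrix (Fin n) (Fin n) F × Matrix (Fin n) (Fin m) F // Reachable s.1 s.2} =
      Nat.card F ^ n * surjCount (Nat.card F) n (m + n - 1) := by
  have h := card_generates (F := F) n (Fin n → F) (Fin m → F) (Module.finrank_fin_fun F)
  rw [Module.finrank_fin_fun] at h
  rw [← h]
  refine Nat.card_congr (Equiv.subtypeEquiv
    (Equiv.prodCongr Matrix.toLin'.toEquiv Matrix.toLin'.toEquiv) fun s => ?_)
  rw [reachable_iff_forall_submodule]
  refine forall_congr' fun W => imp_congr ?_ Iff.rfl
  constructor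
  · rintro h _ ⟨u, rfl⟩
    exact h u
  · exact fun h u => h ⟨u, rfl⟩

/-- Each factor is `q^(m+n-1) (1 - t^(m+n-1-i))`, and reversing the product gives the exponents `m,
…, m+n-1`. The powers of `q` collect to `n + n (m+n-1) = n² + nm`. -/
lemma surjCount_eq_mul_reachPoly (n m : ℕ) (hm : 0 < m) :
    ((Nat.card F ^ n * surjCount (Nat.card F) n (m + n - 1) : ℕ) : ℝ) =
      (Nat.card F : ℝ) ^ (n * n + n * m) * reachPoly n m (1 / (Nat.card F : ℝ)) := by
  set q := Nat.card F
  have hq : 0 < q := Nat.card_pos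
  have hq0 : (q : ℝ) ≠ 0 := by exact_mod_cast hq.ne'
  have hfac : ∀ i ∈ Finset.range n, ((q ^ (m + n - 1) - q ^ i : ℕ) : ℝ) =
      (q : ℝ) ^ (m + n - 1) * (1 - (1 / (q : ℝ)) ^ (m + (n - 1 - i))) := by
    intro i hi
    have hin := Finset.mem_range.1 hi
    rw [Nat.cast_sub (Nat.pow_le_pow_right hq (by omega)), mul_sub, mul_one]
    push_cast
    congr 1
    rw [show m + n - 1 = i + (m + (n - 1 - i)) by omega, one_div, inv_pow, pow_add, mul_assoc]
    rw [mul_inv_cancel₀ (pow_ne_zero _ hq0), mul_one]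
  rw [Nat.cast_mul, surjCount, Fin.prod_univ_eq_prod_range (fun i => q ^ (m + n - 1) - q ^ i) n,
    Nat.cast_prod, Finset.prod_congr rfl hfac, Finset.prod_mul_distrib, Finset.prod_const,
    Finset.card_range, Finset.prod_range_reflect (fun j => 1 - (1 / (q : ℝ)) ^ (m + j)) n,
    reachPoly, Finset.prod_Ico_eq_prod_range, Nat.add_sub_cancel, ← mul_assoc, Nat.cast_pow,
    ← pow_mul, ← pow_add]
  congr 2
  obtain ⟨k, rfl⟩ : ∃ k, m = k + 1 := ⟨m - 1, by omega⟩
  rw [show k + 1 + n - 1 = k + n by omega]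
  ring

end Counting

/-! ### Comparison of the counts. -/

section Main

instance (F : Type*) [Field F] [Finite F] (n : ℕ) : Finite ((Fin n → F) ≃ₗ[F] (Fin n → F)) :=
  have : Finite ((Fin n → F) →ₗ[F] (Fin n → F)) := Module.finite_of_finite F
  Finite.of_injective (fun e => e.toLinearMap) LinearEquiv.toLinearMap_injective

variable (F : Type*) [Field F] [Finite F] (p n m : ℕ)

/-- The systems `(A, B, C, D)` with state space `F^n`. -/
abbrev System (F : Type*) (p n m : ℕ) : Type _ :=
  Matrix (Fin n) (Fin n) F × Matrix (Fin n) (Fin m) F × Matrix (Fin p) (Fin n) F ×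
    Matrix (Fin p) (Fin m) F

theorem finite_matrixSet : (matrixSet F p n m).Finite := by
  have hex : ∀ G : matrixSet F p n m, ∃ s : System F p n m,
      Realizes s.1 s.2.1 s.2.2.1 s.2.2.2 G.1 := fun G => by
    have h := card_realizes G.2
    have h0 : Nat.card ((Fin n → F) ≃ₗ[F] (Fin n → F)) ≠ 0 := Nat.card_pos.ne'
    rw [← h] at h0
    obtain ⟨s, hs⟩ := (Nat.card_ne_zero.1 h0).1
    exact ⟨s, hs⟩
  choose s hs using hex
  refine Set.finite_coe_iff.1 (Finite.of_injective s fun G G' h => ?_)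
  refine Subtype.ext ((existsUnique_realizes (hs G).reachable _ _).unique ⟨G.2, hs G⟩ ⟨G'.2, ?_⟩)
  rw [h]
  exact hs G'

variable {F p n m}

/-- A property of reachable systems which depends only on the realized matrix holds for
`|GL_n(F)|` times as many systems as matrices. -/
lemma card_reachable_and_eq (S : System F p n m → Prop)
    (R : Matrix (Fin m ⊕ Fin p) (Fin m) F[X] → Prop)
    (h : ∀ s, ∀ G ∈ matrixSet F p n m, Realizes s.1 s.2.1 s.2.2.1 s.2.2.2 G → (S s ↔ R G)) :
    Nat.card {s : System F p n m // Reachable s.1 s.2.1 ∧ S s} =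
      (matrixSet F p n m ∩ {G | R G}).ncard * Nat.card ((Fin n → F) ≃ₗ[F] (Fin n → F)) := by
  have hfin := ((finite_matrixSet F p n m).inter_of_left {G | R G})
  have := hfin.fintype
  have hcard : Nat.card (Σ G : ↥(matrixSet F p n m ∩ {G | R G}),
      {s : System F p n m // Realizes s.1 s.2.1 s.2.2.1 s.2.2.2 G.1}) =
      (matrixSet F p n m ∩ {G | R G}).ncard * Nat.card ((Fin n → F) ≃ₗ[F] (Fin n → F)) := by
    rw [Nat.card_sigma, Finset.sum_congr rfl fun G _ => card_realizes G.2.1, Finset.sum_const,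
      Finset.card_univ, smul_eq_mul, ← Nat.card_eq_fintype_card]
    rfl
  rw [← hcard]
  symm
  refine Nat.card_congr (Equiv.ofBijective
    (fun x => ⟨x.2.1, x.2.2.reachable, (h _ _ x.1.2.1 x.2.2).2 x.1.2.2⟩) ⟨?_, ?_⟩)
  · rintro ⟨⟨G, hG, hRG⟩, s, hs⟩ ⟨⟨G', hG', hRG'⟩, s', hs'⟩ heq
    obtain rfl : s = s' := congrArg Subtype.val heq
    obtain rfl : G = G' :=
      (existsUnique_realizes hs.reachable _ _).unique ⟨hG, hs⟩ ⟨hG', hs'⟩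
    rfl
  · rintro ⟨s, hr, hS⟩
    obtain ⟨G, ⟨hG, hs⟩, -⟩ := existsUnique_realizes hr s.2.2.1 s.2.2.2
    exact ⟨⟨⟨G, hG, (h _ _ hG hs).1 hS⟩, s, hs⟩, rfl⟩

lemma card_minimal : Nat.card {s : System F p n m // IsMinimal s.1 s.2.1 s.2.2.1 s.2.2.2} =
    (matrixSet F p n m ∩ {G | IsRightPrime G}).ncard *
      Nat.card ((Fin n → F) ≃ₗ[F] (Fin n → F)) :=
  card_reachable_and_eq (fun s => Observable s.1 s.2.1 s.2.2.1 s.2.2.2) IsRightPrime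
    fun _ _ hG h => h.observable_iff_isRightPrime (mem_matrixSet_iff.1 hG).1

/-- The fibre count for the trivial property: reachability leaves `C` and `D` arbitrary. -/
lemma card_matrixSet_mul :
    (matrixSet F p n m).ncard * Nat.card ((Fin n → F) ≃ₗ[F] (Fin n → F)) =
      Nat.card {s : Matrix (Fin n) (Fin n) F × Matrix (Fin n) (Fin m) F // Reachable s.1 s.2} *
        Nat.card F ^ (p * n + p * m) := by
  have h := card_reachable_and_eq (F := F) (p := p) (n := n) (m := m) (fun _ => True)
    (fun _ => True) fun _ _ _ _ => Iff.rfl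
  rw [show {G : Matrix (Fin m ⊕ Fin p) (Fin m) F[X] | True} = Set.univ from Set.ofPred_true,
    Set.inter_univ] at h
  have hCD : Nat.card (Matrix (Fin p) (Fin n) F × Matrix (Fin p) (Fin m) F) =
      Nat.card F ^ (p * n + p * m) := by
    rw [Module.natCard_eq_pow_finrank (K := F), Module.finrank_prod, Module.finrank_matrix,
      Module.finrank_matrix]
    simp
  rw [← h, ← hCD, ← Nat.card_prod]
  exact Nat.card_congr
    { toFun := fun s => (⟨(s.1.1, s.1.2.1), s.2.1⟩, s.1.2.2)
      invFun := fun x => ⟨(x.1.1.1, x.1.1.2, x.2), x.1.2, trivial⟩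
      left_inv := fun _ => rfl
      right_inv := fun _ => rfl }

theorem reachPoly_pos (hm : 0 < m) : 0 < reachPoly n m (1 / (Nat.card F : ℝ)) := by
  refine Finset.prod_pos fun j hj => sub_pos.2 ?_
  have hq : (1 : ℝ) < Nat.card F := by exact_mod_cast Finite.one_lt_card
  have hj' := (Finset.mem_Ico.1 hj).1
  refine pow_lt_one₀ (by positivity) ?_ (by omega)
  rw [div_lt_one (by linarith)]
  exact hq

theorem cast_card_reachable (hm : 0 < m) :
    (Nat.card {s : Matrix (Fin n) (Fin n) F × Matrix (Fin n) (Fin m) F // Reachable s.1 s.2} : ℝ) =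
      (Nat.card F : ℝ) ^ (n * n + n * m) * reachPoly n m (1 / (Nat.card F : ℝ)) := by
  rw [card_reachable, surjCount_eq_mul_reachPoly n m hm]

/-- A reachable pair exists because its probability is a product of positive factors; with `C = 0`
and `D = 0` it realizes some element. -/
theorem nonempty_matrixSet (hm : 0 < m) : (matrixSet F p n m).Nonempty := by
  have hq : (0 : ℝ) < Nat.card F := by exact_mod_cast Nat.card_pos
  have h := cast_card_reachable (F := F) (n := n) hm
  have h0 : Nat.card {s : Matrix (Fin n) (Fin n) F × Matrix (Fin n) (Fin m) F //
      Reachable s.1 s.2} ≠ 0 := by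
    intro h0
    rw [h0, Nat.cast_zero] at h
    exact (mul_pos (pow_pos hq _) (reachPoly_pos (F := F) (n := n) hm)).ne h
  obtain ⟨s, hs⟩ := (Nat.card_ne_zero.1 h0).1
  obtain ⟨G, ⟨hG, -⟩, -⟩ := existsUnique_realizes (p := p) hs 0 0
  exact ⟨G, hG⟩

lemma uniformProb_univ {α : Type*} (S : Set α) :
    uniformProb Set.univ S = (Nat.card S : ℝ) / Nat.card α := by
  rw [uniformProb, Set.univ_inter, Set.ncard_univ]
  rfl

theorem reachableProb_eq (hm : 0 < m) :
    reachableProb F n m = reachPoly n m (1 / (Nat.card F : ℝ)) := by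
  have hq : (0 : ℝ) < Nat.card F := by exact_mod_cast Nat.card_pos
  have hcard : Nat.card (Matrix (Fin n) (Fin n) F × Matrix (Fin n) (Fin m) F) =
      Nat.card F ^ (n * n + n * m) := by
    rw [Module.natCard_eq_pow_finrank (K := F), Module.finrank_prod, Module.finrank_matrix,
      Module.finrank_matrix]
    simp
  rw [reachableProb, uniformProb_univ, hcard, Nat.cast_pow,
    div_eq_iff (pow_pos hq _).ne', mul_comm]
  exact cast_card_reachable hm

theorem minimalProb_eq (hm : 0 < m) : minimalProb F p n m =
    rightPrimeProb F p n m * reachPoly n m (1 / (Nat.card F : ℝ)) := by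
  have hq : (0 : ℝ) < Nat.card F := by exact_mod_cast Nat.card_pos
  have hcard : Nat.card (System F p n m) =
      Nat.card F ^ (n * n + n * m) * Nat.card F ^ (p * n + p * m) := by
    rw [Module.natCard_eq_pow_finrank (K := F), Module.finrank_prod, Module.finrank_prod,
      Module.finrank_prod, Module.finrank_matrix, Module.finrank_matrix, Module.finrank_matrix,
      Module.finrank_matrix, ← pow_add]
    simp [add_assoc]
  have hM : ((matrixSet F p n m).ncard : ℝ) ≠ 0 := by
    exact_mod_cast (Set.ncard_pos (finite_matrixSet F p n m)).2 (nonempty_matrixSet hm) |>.ne'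
  have hmul := congrArg (Nat.cast : ℕ → ℝ) (card_matrixSet_mul (F := F) (p := p) (n := n) (m := m))
  rw [Nat.cast_mul, Nat.cast_mul, cast_card_reachable hm, Nat.cast_pow] at hmul
  have hmin : minimalProb F p n m = (Nat.card {s : System F p n m //
      IsMinimal s.1 s.2.1 s.2.2.1 s.2.2.2} : ℝ) / Nat.card (System F p n m) :=
    uniformProb_univ _
  rw [hmin, card_minimal, hcard, rightPrimeProb, uniformProb]
  push_cast
  rw [div_mul_eq_mul_div, div_eq_div_iff (mul_pos (pow_pos hq _) (pow_pos hq _)).ne' hM]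
  -- Minimal and reachable systems both carry the factor `|GL_n(F)|`, which `hmul` eliminates.
  linear_combination ((matrixSet F p n m ∩ {G | IsRightPrime G}).ncard : ℝ) * hmul

end Main

end LinSys

theorem mainTheorem10 (F : Type*) [Field F] [Finite F] (p n m : ℕ) (hm : 0 < m) :
    (LinSys.matrixSet F p n m).Finite ∧ (LinSys.matrixSet F p n m).Nonempty ∧
    LinSys.reachableProb F n m = LinSys.reachPoly n m (1 / (Nat.card F : ℝ)) ∧
    LinSys.minimalProb F p n m =
      LinSys.rightPrimeProb F p n m * LinSys.reachPoly n m (1 / (Nat.card F : ℝ)) :=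
  ⟨LinSys.finite_matrixSet F p n m, LinSys.nonempty_matrixSet hm, LinSys.reachableProb_eq hm,
    LinSys.minimalProb_eq hm⟩
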